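/- Let $\mathcal H$ be a real Hilbert space and $g:\mathcal H\to\mathbb R$ a convex Fréchet differentiable function whose gradient $\nabla g$ is Lipschitz continuous on bounded sets and whose set of minimizers $\operatorname{argmin} g$ is non-empty. Let $\alpha>0$, $0<q<1$, $t_0>0$, and let either $\gamma>0,\ \beta\in\mathbb R$ or $\gamma=0,\ \beta>0$; if $\beta<0$ assume also $t_0>|\beta/\gamma|^{1/q}$. Put $\beta(t)=\gamma+\beta/t^q$. Let $\varepsilon:[t_0,+\infty)\to[0,+\infty)$ be a non-increasing function of class $C^1$ with $\lim_{t\to+\infty}\varepsilon(t)=0$ such that (C1) there are $K_1>0$ and $r\in(q,1)$ with $\varepsilon(t)\ge K_1/t^{r+q}$ for all $t$ large enough; (C2) if $\gamma\ne0$, then $\varepsilon(t)\le\dfrac{\alpha}{2\gamma t^q}$ for all $t$ large enough; (C3) there is $K_3>0$ with $\left(\dfrac{\dot\varepsilon(t)}{\varepsilon(t)}\right)^2\le\dfrac{K_3}{t^2}$ for all $t$ large enough. For $u_0,v_0\in\mathcal H$ let $x:[t_0,+\infty)\to\mathcal H$ be a global classical solution ($C^1$ on $[t_0,+\infty)$ and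 $C^2$ on $(t_0,+\infty)$) of $$\ddot x(t)+\frac{\alpha}{t^q}\dot x(t)+\nabla g\big(x(t)+\beta(t)\dot x(t)\big)+\varepsilon(t)x(t)=0\quad(t>t_0),\qquad x(t_0)=u_0,\ \dot x(t_0)=v_0.$$ For $t\ge t_0$ let $g_t(y)=g(y)+\frac{\varepsilon(t)}2\|y\|^2$. Then $g_t$ has a unique minimizer $x_t$ for every $t\ge t_0$, the set $\operatorname{argmin} g$ has a unique element $x^*$ of minimal norm, and, with $r$ as in (C1), the following hold. (i) $x(t)$ converges strongly to $x^*$ as $t\to+\infty$. (ii) As $t\to+\infty$, $$g_t(x(t)+\beta(t)\dot x(t))-g_t(x_t)=\mathcal O\big(t^{2r-2q-2}+\varepsilon(t)t^{r-1}\big),$$ $$g(x(t)+\beta(t)\dot x(t))-\min g=\mathcal O\big(t^{2r-2q-2}+\varepsilon(t)\big),$$ $$\|\dot x(t)\|=\mathcal O\big(t^{r-q-1}+\sqrt{\varepsilon(t)}\,t^{\frac{r-1}2}\big),\qquad \|x(t)-x_t\|=\mathcal O\big(t^{r-1}+\sqrt{\varepsilon(t)}\,t^{\frac{2q+r-1}2}\big).$$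 (iii) If $t^{2q-1}\varepsilon(t)\in L^1[t_0,+\infty)$, then $$\int_{t_0}^{+\infty}t^q\big(g_t(x(t)+\beta(t)\dot x(t))-g_t(x_t)\big)\,dt<+\infty,\qquad \int_{t_0}^{+\infty}t^q\|\dot x(t)\|^2\,dt<+\infty;$$ moreover $$\int_{t_0}^{+\infty}t^{2q}\big\|\nabla g(x(t)+\beta(t)\dot x(t))+\varepsilon(t)x(t)\big\|^2\,dt<+\infty\quad\text{if }\gamma>0,$$ $$\int_{t_0}^{+\infty}t^{2q-1}\big\|\nabla g(x(t)+\beta(t)\dot x(t))\big\|^2\,dt<+\infty\quad\text{if }\gamma=0.$$ -/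

import Mathlib

open Set Filter Topology Asymptotics MeasureTheory

namespace TikhonovDS

/-- The coefficient `β(t) = γ + β / t ^ q` in front of the velocity inside the gradient. -/
noncomputable def betaFun (γ β q t : ℝ) : ℝ := γ + β / t ^ q

/-- The Tikhonov regularized objective `g_t(y) = g(y) + (ε(t) / 2) ‖y‖²`. -/
noncomputable def regObj {H : Type*} [NormedAddCommGroup H]
    (g : H → ℝ) (ε : ℝ → ℝ) (t : ℝ) (y : H) : ℝ :=
  g y + ε t / 2 * ‖y‖ ^ 2

/-- `z` is a global minimizer of `f`, i.e. `z ∈ argmin f`. -/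
def IsMinimizer {H : Type*} (f : H → ℝ) (z : H) : Prop := ∀ y, f z ≤ f y

/-- `z` is an element of minimal norm of `argmin g`. -/
def IsMinNormMinimizer {H : Type*} [NormedAddCommGroup H] (g : H → ℝ) (z : H) : Prop :=
  IsMinimizer g z ∧ ∀ y, IsMinimizer g y → ‖z‖ ≤ ‖y‖

/-- `x` is a global classical solution on `[t₀, ∞)` of
`x'' + (α / t ^ q) x' + ∇g (x + β(t) x') + ε(t) x = 0`, `x(t₀) = u₀`, `x'(t₀) = v₀`:
it is `C¹` on `[t₀, ∞)` (one-sided at `t₀`) and `C²` on `(t₀, ∞)`.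
The values of `x` to the left of `t₀` play no role. -/
structure IsSolution {H : Type*} [NormedAddCommGroup H] [InnerProductSpace ℝ H] [CompleteSpace H]
    (g : H → ℝ) (ε : ℝ → ℝ) (α β γ q t₀ : ℝ) (u₀ v₀ : H) (x : ℝ → H) : Prop where
  contDiffOn_one : ContDiffOn ℝ 1 x (Ici t₀)
  contDiffOn_two : ContDiffOn ℝ 2 x (Ioi t₀)
  initial_position : x t₀ = u₀
  initial_velocity : HasDerivWithinAt x v₀ (Ici t₀) t₀
  equation : ∀ t, t₀ < t →
    deriv (deriv x) t + (α / t ^ q) • deriv x t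
      + gradient g (x t + betaFun γ β q t • deriv x t) + ε t • x t = 0

end TikhonovDS

/-! Each `g_t` is strongly convex with modulus `ε t`, so its minimizer `x_t` is unique, and the
curve `x_t` tends to the minimal-norm minimizer. It remains to show that the trajectory tracks this
curve. With `u = x - x_t`, `v = x'` and `y = x + β(t) v`, the Lyapunov function is `E = t^(2q)
(g_t(y) - g_t(x_t)) + ‖l u + t^q v‖² / 2 + σ ‖u‖² / 2`. The constants `l = α/4` and `σ = l (α - l)`
make the `⟨u, v⟩` terms of `E'` cancel up to small errors, while the weight `t^(2q)` makes the
leading `⟨∇g_t(y), v⟩` terms cancel.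

The curve `x_t` is not assumed differentiable. It does satisfy `‖x_s - x_t‖ ≤ (ε t - ε s) / ε t * R`
for `s ≥ t`, so to the right of `t` the energy lies below a majorant with `x_t` frozen, which is
differentiable at `t` and touches `E` there. This bounds the upper right Dini derivative and gives
`E' ≤ -D + C F` in that sense, where `D` is `dissipation` and `F = t^(r-2) + t^(2q-1) ε` is
`forcing` (`energy_slope_lt`).

The lower bound on `ε` gives `D ≥ c t^(-r) E` (`energy_le_dissipation`). Since `r < 1`, the function
`t^r F` decays at relative speed at most of order `1/t`, slower than the damping rate `c t^(-r)`. A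
large multiple of it is therefore a barrier, and `E = O(t^r F)` (`energy_le`). All the rates are
read off from this bound. Strong convergence also needs the quadratic growth of `g_t`
(`tendsto_sub`). When `F` is integrable, integrating the differential inequality bounds `∫ D`
(`integrableOn_dissipation`), which yields the integral estimates. -/

namespace TikhonovDS

/-! ### Strong convexity of the regularized objectives and the curve of their minimizers. -/

section Convex

variable {H : Type*} [NormedAddCommGroup H] [InnerProductSpace ℝ H]

theorem norm_add_sq_sub_split (e : ℝ) (y z : H) :
    e / 2 * ‖z‖ ^ 2 = e / 2 * ‖y‖ ^ 2 + inner ℝ (e • y) (z - y) + e / 2 * ‖z - y‖ ^ 2 := by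
  have h : ‖z‖ ^ 2 = ‖y + (z - y)‖ ^ 2 := by congr 2; abel
  rw [h, norm_add_sq_real, real_inner_smul_left]
  ring

theorem norm_midpoint_sq (y z : H) :
    ‖(1 / 2 : ℝ) • y + (1 / 2 : ℝ) • z‖ ^ 2
      = 1 / 2 * ‖y‖ ^ 2 + 1 / 2 * ‖z‖ ^ 2 - 1 / 4 * ‖y - z‖ ^ 2 := by
  rw [norm_add_sq_real, norm_sub_sq_real, real_inner_smul_left, real_inner_smul_right, norm_smul,
    norm_smul, Real.norm_of_nonneg (by norm_num)]
  ring

variable {g : H → ℝ}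

theorem convex_midpoint (hg : ConvexOn ℝ univ g) (y z : H) :
    g ((1 / 2 : ℝ) • y + (1 / 2 : ℝ) • z) ≤ 1 / 2 * g y + 1 / 2 * g z := by
  simpa using hg.2 (mem_univ y) (mem_univ z) (by norm_num : (0 : ℝ) ≤ 1 / 2)
    (by norm_num : (0 : ℝ) ≤ 1 / 2) (by norm_num)

theorem regObj_midpoint (hg : ConvexOn ℝ univ g) (e : ℝ) (y z : H) :
    g ((1 / 2 : ℝ) • y + (1 / 2 : ℝ) • z) + e / 2 * ‖(1 / 2 : ℝ) • y + (1 / 2 : ℝ) • z‖ ^ 2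
      + e / 8 * ‖y - z‖ ^ 2
      ≤ 1 / 2 * (g y + e / 2 * ‖y‖ ^ 2) + 1 / 2 * (g z + e / 2 * ‖z‖ ^ 2) := by
  rw [norm_midpoint_sq]
  linarith [convex_midpoint hg y z]

theorem isMinNormMinimizer_unique (hg : ConvexOn ℝ univ g) {z₁ z₂ : H}
    (h₁ : IsMinNormMinimizer g z₁) (h₂ : IsMinNormMinimizer g z₂) : z₁ = z₂ := by
  have hm : IsMinimizer g ((1 / 2 : ℝ) • z₁ + (1 / 2 : ℝ) • z₂) := fun y => by
    linarith [convex_midpoint hg z₁ z₂, h₁.1 y, h₂.1 y]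
  have hn : ‖z₁‖ = ‖z₂‖ := le_antisymm (h₁.2 _ h₂.1) (h₂.2 _ h₁.1)
  have h3 := pow_le_pow_left₀ (norm_nonneg _) (h₁.2 _ hm) 2
  rw [norm_midpoint_sq, ← hn] at h3
  have h4 : ‖z₁ - z₂‖ ^ 2 ≤ 0 := by linarith
  have h5 : ‖z₁ - z₂‖ = 0 := by
    have := sq_nonneg ‖z₁ - z₂‖
    exact pow_eq_zero_iff (two_ne_zero) |>.1 (le_antisymm h4 this)
  exact sub_eq_zero.1 (norm_eq_zero.1 h5)

theorem minimizer_regObj_unique (hg : ConvexOn ℝ univ g) {e : ℝ} (he : 0 < e) {z₁ z₂ : H}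
    (h₁ : IsMinimizer (fun y => g y + e / 2 * ‖y‖ ^ 2) z₁)
    (h₂ : IsMinimizer (fun y => g y + e / 2 * ‖y‖ ^ 2) z₂) : z₁ = z₂ := by
  have h3 := regObj_midpoint hg e z₁ z₂
  have h4 := h₁ ((1 / 2 : ℝ) • z₁ + (1 / 2 : ℝ) • z₂)
  have h5 := h₂ z₁
  simp only at h4 h5
  have h6 : e / 8 * ‖z₁ - z₂‖ ^ 2 ≤ 0 := by linarith
  have h7 : ‖z₁ - z₂‖ ^ 2 ≤ 0 := by
    by_contra! h
    have := mul_pos (by positivity : 0 < e / 8) h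
    linarith
  have h8 : ‖z₁ - z₂‖ = 0 :=
    pow_eq_zero_iff (two_ne_zero) |>.1 (le_antisymm h7 (sq_nonneg _))
  exact sub_eq_zero.1 (norm_eq_zero.1 h8)

theorem norm_minimizer_regObj_le {H : Type*} [NormedAddCommGroup H] {g : H → ℝ} {e : ℝ} (he : 0 < e) {z w : H}
    (hz : IsMinimizer (fun y => g y + e / 2 * ‖y‖ ^ 2) z) (hw : IsMinimizer g w) :
    ‖z‖ ≤ ‖w‖ := by
  have h1 := hz w
  have h2 := hw z
  simp only at h1
  have h3 : e / 2 * ‖z‖ ^ 2 ≤ e / 2 * ‖w‖ ^ 2 := by linarith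
  exact le_of_sq_le_sq (le_of_mul_le_mul_left h3 (by positivity)) (norm_nonneg _)

section Existence

variable [CompleteSpace H]

/-- The quadratic gain in `regObj_midpoint` makes any minimizing sequence Cauchy, so completeness
suffices and no weak compactness is needed. -/
theorem exists_minimizer_regObj (hg : ConvexOn ℝ univ g) (hc : Continuous g)
    (hb : ∃ z, IsMinimizer g z) {e : ℝ} (he : 0 < e) :
    ∃ z, IsMinimizer (fun y => g y + e / 2 * ‖y‖ ^ 2) z := by
  obtain ⟨z₀, hz₀⟩ := hb
  set f : H → ℝ := fun y => g y + e / 2 * ‖y‖ ^ 2 with hf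
  have hfc : Continuous f := by fun_prop
  have hbd : BddBelow (range f) := ⟨g z₀, by
    rintro _ ⟨y, rfl⟩
    have := hz₀ y
    have : 0 ≤ e / 2 * ‖y‖ ^ 2 := by positivity
    simp only [hf]; linarith⟩
  set m := sInf (range f)
  have hm : ∀ y, m ≤ f y := fun y => csInf_le hbd ⟨y, rfl⟩
  have hex : ∀ n : ℕ, ∃ y, f y < m + 1 / (n + 1) := fun n => by
    have : m < m + 1 / ((n : ℝ) + 1) := by
      have : (0 : ℝ) < 1 / ((n : ℝ) + 1) := by positivity
      linarith
    obtain ⟨_, ⟨y, rfl⟩, hy⟩ := exists_lt_of_csInf_lt (range_nonempty f) this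
    exact ⟨y, hy⟩
  choose y hy using hex
  have hdist : ∀ n k : ℕ, n ≤ k → ‖y n - y k‖ ^ 2 ≤ 8 / e * (1 / (n + 1)) := fun n k hnk => by
    have h1 := regObj_midpoint hg e (y n) (y k)
    have h2 := hm ((1 / 2 : ℝ) • y n + (1 / 2 : ℝ) • y k)
    have h3 := hy n
    have h4 := hy k
    have h5 : (1 : ℝ) / (k + 1) ≤ 1 / (n + 1) := by gcongr
    simp only [hf] at h2 h3 h4
    have h6 : e / 8 * ‖y n - y k‖ ^ 2 ≤ 1 / (n + 1) := by linarith
    calc ‖y n - y k‖ ^ 2 = 8 / e * (e / 8 * ‖y n - y k‖ ^ 2) := by field_simp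
      _ ≤ _ := by gcongr
  have hlim0 : Tendsto (fun n : ℕ => √(8 / e * (1 / ((n : ℝ) + 1)))) atTop (𝓝 0) := by
    have := (tendsto_one_div_add_atTop_nhds_zero_nat (𝕜 := ℝ)).const_mul (8 / e)
    simpa using this.sqrt
  have hcau : CauchySeq y := by
    refine cauchySeq_of_le_tendsto_0' _ (fun n k hnk => ?_) hlim0
    rw [dist_eq_norm]
    exact Real.le_sqrt_of_sq_le (hdist n k hnk)
  obtain ⟨z, hz⟩ := cauchySeq_tendsto_of_complete hcau
  have h1 : Tendsto (fun n => f (y n)) atTop (𝓝 (f z)) := (hfc.tendsto z).comp hz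
  have h2 : Tendsto (fun n : ℕ => m + 1 / ((n : ℝ) + 1)) atTop (𝓝 (m + 0)) :=
    tendsto_const_nhds.add tendsto_one_div_add_atTop_nhds_zero_nat
  have h3 : f z ≤ m := by
    simpa using le_of_tendsto_of_tendsto' h1 h2 (fun n => (hy n).le)
  exact ⟨z, fun w => h3.trans (hm w)⟩

theorem convex_gradient_le (hg : ConvexOn ℝ univ g) (hd : Differentiable ℝ g) (y z : H) :
    g y + inner ℝ (gradient g y) (z - y) ≤ g z := by
  set φ : ℝ → ℝ := fun s => g (AffineMap.lineMap y z s) with hφ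
  have hconv : ConvexOn ℝ univ φ := by
    have h := hg.comp_affineMap (AffineMap.lineMap y z : ℝ →ᵃ[ℝ] H)
    rwa [preimage_univ] at h
  have hder : HasDerivAt φ (inner ℝ (gradient g y) (z - y)) 0 := by
    have h1 : HasFDerivAt g (fderiv ℝ g y) (AffineMap.lineMap y z (0 : ℝ)) := by
      simpa using (hd y).hasFDerivAt
    have h2 := h1.comp_hasDerivAt (0 : ℝ) (AffineMap.hasDerivAt_lineMap (a := y) (b := z))
    rwa [inner_gradient_left]
  have := hconv.le_slope_of_hasDerivAt (mem_univ 0) (mem_univ 1) one_pos hder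
  simp only [slope_def_field, hφ, AffineMap.lineMap_apply_zero, AffineMap.lineMap_apply_one] at this
  linarith

theorem regObj_gradient_le (hg : ConvexOn ℝ univ g) (hd : Differentiable ℝ g) (e : ℝ) (y z : H) :
    g y + e / 2 * ‖y‖ ^ 2 + inner ℝ (gradient g y + e • y) (z - y) + e / 2 * ‖z - y‖ ^ 2
      ≤ g z + e / 2 * ‖z‖ ^ 2 := by
  have h1 := convex_gradient_le hg hd y z
  have h2 := norm_add_sq_sub_split e y z
  rw [inner_add_left]
  linarith

theorem gradient_add_smul_eq_zero (hd : Differentiable ℝ g) {e : ℝ} {z : H}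
    (hz : IsMinimizer (fun y => g y + e / 2 * ‖y‖ ^ 2) z) : gradient g z + e • z = 0 := by
  have h1 : HasFDerivAt (fun y => g y + e / 2 * ‖y‖ ^ 2)
      (fderiv ℝ g z + (e / 2) • (2 • (innerSL ℝ z))) z :=
    (hd z).hasFDerivAt.add ((hasStrictFDerivAt_norm_sq z).hasFDerivAt.const_mul (e / 2))
  have h2 : IsLocalMin (fun y => g y + e / 2 * ‖y‖ ^ 2) z := Eventually.of_forall hz
  have h3 := h2.hasFDerivAt_eq_zero h1
  refine ext_inner_right ℝ fun v => ?_
  have h4 := congrArg (fun l => l v) h3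
  simp at h4
  rw [inner_add_left, inner_gradient_left, real_inner_smul_left, inner_zero_left]
  linarith

theorem regObj_quadratic_growth (hg : ConvexOn ℝ univ g) (hd : Differentiable ℝ g) {e : ℝ} {z : H}
    (hz : IsMinimizer (fun y => g y + e / 2 * ‖y‖ ^ 2) z) (y : H) :
    g z + e / 2 * ‖z‖ ^ 2 + e / 2 * ‖y - z‖ ^ 2 ≤ g y + e / 2 * ‖y‖ ^ 2 := by
  have := regObj_gradient_le hg hd e z y
  rwa [gradient_add_smul_eq_zero hd hz, inner_zero_left, add_zero] at this

/-- Adding the quadratic growth inequalities at the two minimizers eliminates `g`. The resulting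
bound makes the norms monotone along the curve and turns their convergence into the Cauchy property
of the curve itself. -/
theorem minimizer_regObj_sub_sq_le (hg : ConvexOn ℝ univ g) (hd : Differentiable ℝ g)
    {e₁ e₂ : ℝ} (h₂ : 0 < e₂) (h₁₂ : e₂ ≤ e₁) {z₁ z₂ : H}
    (hz₁ : IsMinimizer (fun y => g y + e₁ / 2 * ‖y‖ ^ 2) z₁)
    (hz₂ : IsMinimizer (fun y => g y + e₂ / 2 * ‖y‖ ^ 2) z₂) :
    ‖z₁ - z₂‖ ^ 2 ≤ ‖z₂‖ ^ 2 - ‖z₁‖ ^ 2 := by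
  have h3 := regObj_quadratic_growth hg hd hz₁ z₂
  have h4 := regObj_quadratic_growth hg hd hz₂ z₁
  rw [norm_sub_rev] at h3
  have h5 : (e₁ + e₂) * ‖z₁ - z₂‖ ^ 2 ≤ (e₁ - e₂) * (‖z₂‖ ^ 2 - ‖z₁‖ ^ 2) := by linarith
  have h6 : 0 ≤ (e₁ + e₂) * ‖z₁ - z₂‖ ^ 2 := by
    have : 0 ≤ e₁ + e₂ := by linarith
    positivity
  have hp : 0 < e₁ + e₂ := by linarith
  refine le_of_mul_le_mul_left (h5.trans ?_) hp
  -- The sign of `‖z₂‖ ^ 2 - ‖z₁‖ ^ 2` follows from `h5` only when `e₂ < e₁`; for equal parameters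
  -- the two minimizers coincide.
  rcases h₁₂.eq_or_lt with h | h
  · subst h
    have : ‖z₁ - z₂‖ ^ 2 ≤ 0 := by nlinarith
    have h8 : ‖z₁ - z₂‖ = 0 :=
      pow_eq_zero_iff (two_ne_zero) |>.1 (le_antisymm this (sq_nonneg _))
    rw [sub_eq_zero.1 (norm_eq_zero.1 h8)]
    simp
  · have h9 : 0 ≤ ‖z₂‖ ^ 2 - ‖z₁‖ ^ 2 := by
      by_contra! h10
      have := mul_neg_of_pos_of_neg (sub_pos.2 h) h10
      linarith
    gcongr
    linarith

/-- Replaces the derivative of the curve of minimizers: its speed is controlled by `|ε'| / ε` times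
a norm bound. -/
theorem norm_minimizer_regObj_sub_le (hg : ConvexOn ℝ univ g) (hd : Differentiable ℝ g)
    {e₁ e₂ : ℝ} (h₁ : 0 < e₁) {z₁ z₂ : H}
    (hz₁ : IsMinimizer (fun y => g y + e₁ / 2 * ‖y‖ ^ 2) z₁)
    (hz₂ : IsMinimizer (fun y => g y + e₂ / 2 * ‖y‖ ^ 2) z₂) :
    ‖z₂ - z₁‖ ≤ |e₁ - e₂| / e₁ * ‖z₂‖ := by
  have h3 := regObj_quadratic_growth hg hd hz₁ z₂
  have h4 := regObj_quadratic_growth hg hd hz₂ z₁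
  rw [norm_sub_rev z₁ z₂] at h4
  have h5 := norm_add_sq_sub_split (e₁ - e₂) z₂ z₁
  rw [norm_sub_rev z₁ z₂, real_inner_smul_left] at h5
  have h6 : e₁ * ‖z₂ - z₁‖ ^ 2 ≤ - ((e₁ - e₂) * inner ℝ z₂ (z₁ - z₂)) := by linarith
  have h7 : - ((e₁ - e₂) * inner ℝ z₂ (z₁ - z₂)) ≤ |e₁ - e₂| * (‖z₂‖ * ‖z₂ - z₁‖) := by
    rw [norm_sub_rev z₂ z₁]
    refine (neg_le_abs _).trans ?_
    rw [abs_mul]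
    gcongr
    exact abs_real_inner_le_norm _ _
  rcases (norm_nonneg (z₂ - z₁)).eq_or_lt with h8 | h8
  · rw [← h8]; positivity
  · have h9 : (e₁ * ‖z₂ - z₁‖) * ‖z₂ - z₁‖ ≤ (|e₁ - e₂| * ‖z₂‖) * ‖z₂ - z₁‖ := by
      calc _ = e₁ * ‖z₂ - z₁‖ ^ 2 := by ring
        _ ≤ _ := h6.trans h7
        _ = _ := by ring
    have h10 := le_of_mul_le_mul_right h9 h8
    rw [div_mul_eq_mul_div, le_div_iff₀ h₁]
    linarith

/-- Along any vanishing sequence of positive parameters the Tikhonov minimizers converge to a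
minimizer of minimal norm. -/
theorem exists_tendsto_minimizer_regObj (hg : ConvexOn ℝ univ g) (hd : Differentiable ℝ g)
    {t₀ : ℝ} {ε : ℝ → ℝ} (hpos : ∀ t ∈ Ici t₀, 0 < ε t) (hanti : AntitoneOn ε (Ici t₀))
    (hlim : Tendsto ε atTop (𝓝 0)) (hb : ∃ z, IsMinimizer g z) {z : ℝ → H}
    (hz : ∀ t ∈ Ici t₀, IsMinimizer (regObj g ε t) (z t)) :
    ∃ w, IsMinNormMinimizer g w ∧ Tendsto z atTop (𝓝 w) := by
  obtain ⟨z₀, hz₀⟩ := hb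
  have hle : ∀ w, IsMinimizer g w → ∀ t ∈ Ici t₀, ‖z t‖ ≤ ‖w‖ := fun w hw t ht =>
    norm_minimizer_regObj_le (hpos t ht) (hz t ht) hw
  have hsub : ∀ s ∈ Ici t₀, ∀ t ∈ Ici t₀, s ≤ t → ‖z s - z t‖ ^ 2 ≤ ‖z t‖ ^ 2 - ‖z s‖ ^ 2 :=
    fun s hs t ht hst => minimizer_regObj_sub_sq_le hg hd (hpos t ht) (hanti hs ht hst)
      (hz s hs) (hz t ht)
  -- Truncating at `t₀` makes the function monotone on all of `ℝ`, so that monotone convergence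
  -- applies.
  set ν : ℝ → ℝ := fun t => ‖z (max t t₀)‖ ^ 2 with hν
  have hmono : Monotone ν := fun s t hst => by
    have h := hsub _ (le_max_right s t₀) _ (le_max_right t t₀) (max_le_max_right t₀ hst)
    have := sq_nonneg ‖z (max s t₀) - z (max t t₀)‖
    simp only [hν]; linarith
  have hbdd : BddAbove (range ν) := ⟨‖z₀‖ ^ 2, by
    rintro _ ⟨t, rfl⟩
    exact pow_le_pow_left₀ (norm_nonneg _) (hle z₀ hz₀ _ (le_max_right t t₀)) 2⟩
  set S := ⨆ t, ν t
  have hνS : Tendsto ν atTop (𝓝 S) := tendsto_atTop_ciSup hmono hbdd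
  have hνle : ∀ t, ν t ≤ S := fun t => le_ciSup hbdd t
  have hcau : Cauchy (map z atTop) := by
    rw [Metric.cauchy_iff]
    refine ⟨inferInstance, fun δ hδ => ?_⟩
    have h1 : ∀ᶠ t in atTop, S - (δ / 2) ^ 2 < ν t :=
      hνS.eventually (lt_mem_nhds (by have : 0 < (δ / 2) ^ 2 := by positivity
                                      linarith))
    obtain ⟨T, hT, hT0⟩ := (h1.and (eventually_ge_atTop t₀)).exists
    have key : ∀ t ∈ Ici T, ‖z T - z t‖ < δ / 2 := fun t ht => by
      have h2 := hsub T hT0 t (hT0.trans ht) ht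
      have h3 := hνle t
      simp only [hν, max_eq_left hT0, max_eq_left (hT0.trans ht : t₀ ≤ t)] at h3 hT
      exact lt_of_pow_lt_pow_left₀ 2 (by positivity) (by linarith)
    refine ⟨z '' Ici T, image_mem_map (Ici_mem_atTop T), ?_⟩
    rintro _ ⟨s, hs, rfl⟩ _ ⟨t, ht, rfl⟩
    have h4 := dist_triangle_left (z s) (z t) (z T)
    rw [dist_eq_norm (z T), dist_eq_norm (z T)] at h4
    linarith [key s hs, key t ht]
  obtain ⟨w, hw⟩ := cauchy_iff_exists_le_nhds.1 hcau
  have hw : Tendsto z atTop (𝓝 w) := hw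
  refine ⟨w, ⟨fun y => ?_, fun y hy => ?_⟩, hw⟩
  · have h1 : Tendsto (fun t => g (z t)) atTop (𝓝 (g w)) := (hd.continuous.tendsto w).comp hw
    have h2 : Tendsto (fun t => g y + ε t / 2 * ‖y‖ ^ 2) atTop (𝓝 (g y + 0 / 2 * ‖y‖ ^ 2)) :=
      tendsto_const_nhds.add ((hlim.div_const 2).mul_const _)
    simp only [zero_div, zero_mul, add_zero] at h2
    refine le_of_tendsto_of_tendsto h1 h2 ?_
    filter_upwards [eventually_ge_atTop t₀] with t ht
    have h3 := hz t ht y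
    have h4 : 0 ≤ ε t / 2 * ‖z t‖ ^ 2 := by have := hpos t ht; positivity
    simp only [regObj] at h3
    linarith
  · refine le_of_tendsto hw.norm ?_
    filter_upwards [eventually_ge_atTop t₀] with t ht using hle y hy t ht

end Existence

end Convex

/-! ### The pointwise dissipation inequality. -/

theorem young_mul_le {c : ℝ} (hc : 0 < c) (a x : ℝ) :
    a * x ≤ c / 16 * x ^ 2 + 4 * a ^ 2 / c := by
  have h : c / 16 * x ^ 2 + 4 * a ^ 2 / c - a * x = (c * x / 4 - 2 * a) ^ 2 / c := by
    field_simp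
    ring
  have : 0 ≤ (c * x / 4 - 2 * a) ^ 2 / c := by positivity
  linarith

/-- Here `U`, `N`, `P`, `Q` stand for `‖u‖`, `‖X‖`, `‖p‖`, `‖u + b X‖`, with `X` the velocity and
`p` the gradient of `g_t` at `u + b X + x_t`. Budget: `l τ G` pays `α/8` for the growth of the
weight and keeps `α/8`. The friction `(κ - l) τ N²` starts from `α/8`, pays `α/16` and `α/32`, and
keeps `α/32`. The strong convexity term supplies `l τ e U² / 4`; three Young inequalities cost
`1/16` each, leaving `l/16 = α/64`. -/
theorem energy_dissipation_scalar
    {α q τ ρ b e e' k R A m κ l σ G Y η' U N P Q w iuX ipX iup : ℝ}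
    (hα : 0 < α) (hl : l = α / 4) (hσ : σ = l * (α - l)) (hq : 0 < q) (hτ : 0 < τ)
    (hρ : 0 < ρ) (hb : 0 < b) (he : 0 < e) (hA : 0 ≤ A) (hR : 0 ≤ R) (hk : 0 ≤ k)
    (hY : 0 ≤ Y) (he'0 : e' ≤ 0) (he' : -e' ≤ k * ρ * e) (hη' : η' ≤ k * ρ * R)
    (hG0 : 0 ≤ G) (hG : G + e / 2 * Q ^ 2 ≤ iup + b * ipX)
    (hm : |m - 1| * τ ≤ A * b)
    (hκ : κ = α - q * τ * ρ - τ * e * b) (hκα : 3 * α / 8 ≤ κ)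
    (h1 : 2 * q * τ * ρ ≤ α / 8)
    (h2 : (A + l) ^ 2 * b / 2 + 9 / 2 * l * τ * e * b ^ 2 + 4 * l * q ^ 2 * τ * (ρ ^ 2 / e)
      ≤ α / 32 * τ)
    (hU0 : 0 ≤ U) (hcs1 : |ipX| ≤ P * N) (hcs2 : |iuX| ≤ U * N)
    (hnorm : U ^ 2 ≤ 2 * Q ^ 2 + 2 * b ^ 2 * N ^ 2) (hw0 : 0 ≤ w) (hw : w ≤ l * U + τ * N) :
    2 * q * τ ^ 2 * ρ * G
        + τ ^ 2 * (m * ipX - b * P ^ 2 + e' / 2 * Y - e' / 2 * R ^ 2)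
        + (l * (l - κ) * iuX - l * τ * iup + τ * (l - κ) * N ^ 2 - τ ^ 2 * ipX) + l * (w * η')
        + σ * (iuX + U * η')
      ≤ -(α / 8) * τ * G - α / 32 * τ * N ^ 2 - 1 / 2 * τ ^ 2 * b * P ^ 2
        - α / 64 * τ * e * U ^ 2
        + (k * R ^ 2 / 2 * (τ ^ 2 * ρ * e)
          + 4 * ((l ^ 2 + σ) * k * R) ^ 2 / l * (ρ ^ 2 / (τ * e))
          + 4 * (l * k * R) ^ 2 / α * (τ * ρ ^ 2)) := by
  have hl0 : 0 < l := by rw [hl]; positivity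
  have hσ0 : 0 < σ := by rw [hσ, hl]; nlinarith
  have hkρR : 0 ≤ k * ρ * R := by positivity
  have hwη : w * η' ≤ (l * U + τ * N) * (k * ρ * R) :=
    (mul_le_mul_of_nonneg_left hη' hw0).trans (mul_le_mul_of_nonneg_right hw hkρR)
  have huη : U * η' ≤ U * (k * ρ * R) := mul_le_mul_of_nonneg_left hη' hU0
  -- The part of `⟨p, X⟩` that survives cancellation has size `b τ`, so half of `τ² b P²` absorbs it
  -- at the price of a kinetic term of order `b`.
  have hcross : τ ^ 2 * ((m - 1) * ipX) + l * τ * (b * ipX)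
      ≤ 1 / 2 * τ ^ 2 * b * P ^ 2 + (A + l) ^ 2 * b / 2 * N ^ 2 := by
    have h3 : τ * ((m - 1) * ipX) ≤ A * b * (P * N) := by
      calc τ * ((m - 1) * ipX) ≤ |τ * ((m - 1) * ipX)| := le_abs_self _
        _ = |m - 1| * τ * |ipX| := by rw [abs_mul, abs_mul, abs_of_pos hτ]; ring
        _ ≤ A * b * (P * N) := by gcongr
    have h4 : ipX ≤ P * N := (le_abs_self _).trans hcs1
    have h5 : l * b * ipX ≤ l * b * (P * N) := by gcongr
    have h6 : τ ^ 2 * ((m - 1) * ipX) + l * τ * (b * ipX) ≤ τ * ((A + l) * b * (P * N)) := by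
      have : τ * (τ * ((m - 1) * ipX) + l * b * ipX) ≤ τ * (A * b * (P * N) + l * b * (P * N)) := by
        gcongr
      linarith
    have h7 : 0 ≤ b / 2 * (τ * P - (A + l) * N) ^ 2 := by positivity
    linarith
  have hmix : l * (q * τ * ρ + τ * e * b) * iuX
      ≤ l * τ * (e / 16 * U ^ 2 + 4 * (q * ρ * N) ^ 2 / e)
        + l * τ * (e / 16 * U ^ 2 + 4 * (e * b * N) ^ 2 / e) := by
    have h3 : iuX ≤ U * N := (le_abs_self _).trans hcs2
    calc l * (q * τ * ρ + τ * e * b) * iuX ≤ l * (q * τ * ρ + τ * e * b) * (U * N) := by gcongr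
      _ = l * τ * ((q * ρ * N) * U) + l * τ * ((e * b * N) * U) := by ring
      _ ≤ _ := by
        gcongr
        · exact young_mul_le he _ _
        · exact young_mul_le he _ _
  have hd1 : 4 * (q * ρ * N) ^ 2 / e = 4 * q ^ 2 * (ρ ^ 2 / e) * N ^ 2 := by ring
  have hd2 : 4 * (e * b * N) ^ 2 / e = 4 * e * b ^ 2 * N ^ 2 := by field_simp
  rw [hd1, hd2] at hmix
  have hlinU := young_mul_le (c := l * τ * e) (by positivity) ((l ^ 2 + σ) * k * R * ρ) U
  have hd3 : 4 * ((l ^ 2 + σ) * k * R * ρ) ^ 2 / (l * τ * e)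
      = 4 * ((l ^ 2 + σ) * k * R) ^ 2 / l * (ρ ^ 2 / (τ * e)) := by
    field_simp
  rw [hd3] at hlinU
  have hlinN := mul_le_mul_of_nonneg_left (young_mul_le hα (l * k * R * ρ) N) hτ.le
  have hd4 : τ * (α / 16 * N ^ 2 + 4 * (l * k * R * ρ) ^ 2 / α)
      = α / 16 * τ * N ^ 2 + 4 * (l * k * R) ^ 2 / α * (τ * ρ ^ 2) := by ring
  rw [hd4] at hlinN
  have hforce : τ ^ 2 * (e' / 2 * Y - e' / 2 * R ^ 2) ≤ k * R ^ 2 / 2 * (τ ^ 2 * ρ * e) := by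
    have h3 : e' / 2 * Y ≤ 0 := mul_nonpos_of_nonpos_of_nonneg (by linarith) hY
    have h4 : -e' / 2 * R ^ 2 ≤ k * ρ * e / 2 * R ^ 2 := by gcongr
    calc _ ≤ τ ^ 2 * (k * ρ * e / 2 * R ^ 2) := by gcongr; linarith
      _ = _ := by ring
  have hGt : 2 * q * τ ^ 2 * ρ * G ≤ α / 8 * τ * G := by
    calc _ = (2 * q * τ * ρ) * (τ * G) := by ring
      _ ≤ α / 8 * (τ * G) := by gcongr
      _ = _ := by ring
  have hGp : l * τ * G + l * τ * (e / 2 * Q ^ 2) ≤ l * τ * (iup + b * ipX) := by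
    rw [← mul_add]
    gcongr
  have hnorm' : l * τ * (e / 4) * U ^ 2
      ≤ l * τ * (e / 4) * (2 * Q ^ 2 + 2 * b ^ 2 * N ^ 2) := by gcongr
  have hNκ : (κ - l) * τ * N ^ 2 ≥ α / 8 * τ * N ^ 2 := by
    have : α / 8 ≤ κ - l := by rw [hl]; linarith
    gcongr
  have h2' := mul_le_mul_of_nonneg_right h2 (sq_nonneg N)
  have hwη' := mul_le_mul_of_nonneg_left hwη hl0.le
  have huη' := mul_le_mul_of_nonneg_left huη hσ0.le
  -- This is why `σ = l (α - l)`: the main `⟨u, X⟩` terms cancel, and what is left is `l (α - κ) ⟨u,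
  -- X⟩`, treated in `hmix`.
  have hσκ : σ = l * (κ - l) + l * (q * τ * ρ + τ * e * b) := by rw [hσ, hκ]; ring
  have hσi : σ * iuX = l * (κ - l) * iuX + l * (q * τ * ρ + τ * e * b) * iuX := by
    rw [hσκ]; ring
  have hlα : l * τ * G = α / 4 * τ * G := by rw [hl]
  have hlU : l * τ * e * U ^ 2 = α / 4 * τ * e * U ^ 2 := by rw [hl]
  linarith

/-- The pointwise dissipation estimate for the energy; `τ` stands for `t ^ q`, `ρ` for `1 / t`. -/
theorem energy_dissipation {H : Type*} [NormedAddCommGroup H] [InnerProductSpace ℝ H]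
    {α q τ ρ b e e' k R A m κ l σ G Y η' : ℝ} {u X p : H}
    (hα : 0 < α) (hl : l = α / 4) (hσ : σ = l * (α - l)) (hq : 0 < q) (hτ : 0 < τ)
    (hρ : 0 < ρ) (hb : 0 < b) (he : 0 < e) (hA : 0 ≤ A) (hR : 0 ≤ R) (hk : 0 ≤ k)
    (hY : 0 ≤ Y) (he'0 : e' ≤ 0) (he' : -e' ≤ k * ρ * e) (hη' : η' ≤ k * ρ * R)
    (hG0 : 0 ≤ G) (hG : G + e / 2 * ‖u + b • X‖ ^ 2 ≤ inner ℝ p (u + b • X))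
    (hm : |m - 1| * τ ≤ A * b)
    (hκ : κ = α - q * τ * ρ - τ * e * b) (hκα : 3 * α / 8 ≤ κ)
    (h1 : 2 * q * τ * ρ ≤ α / 8)
    (h2 : (A + l) ^ 2 * b / 2 + 9 / 2 * l * τ * e * b ^ 2 + 4 * l * q ^ 2 * τ * (ρ ^ 2 / e)
      ≤ α / 32 * τ) :
    2 * q * τ ^ 2 * ρ * G
        + τ ^ 2 * (inner ℝ p (m • X - b • p) + e' / 2 * Y - e' / 2 * R ^ 2)
        + inner ℝ (l • u + τ • X) ((l - κ) • X - τ • p) + l * (‖l • u + τ • X‖ * η')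
        + σ * (inner ℝ u X + ‖u‖ * η')
      ≤ -(α / 8) * τ * G - α / 32 * τ * ‖X‖ ^ 2 - 1 / 2 * τ ^ 2 * b * ‖p‖ ^ 2
        - α / 64 * τ * e * ‖u‖ ^ 2
        + (k * R ^ 2 / 2 * (τ ^ 2 * ρ * e)
          + 4 * ((l ^ 2 + σ) * k * R) ^ 2 / l * (ρ ^ 2 / (τ * e))
          + 4 * (l * k * R) ^ 2 / α * (τ * ρ ^ 2)) := by
  have hl0 : 0 < l := by rw [hl]; positivity
  set U := ‖u‖ with hU
  set N := ‖X‖ with hN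
  set P := ‖p‖ with hP
  have hU0 : 0 ≤ U := norm_nonneg _
  have hN0 : 0 ≤ N := norm_nonneg _
  have hP0 : 0 ≤ P := norm_nonneg _
  set iuX : ℝ := inner ℝ u X with hiuX
  set ipX : ℝ := inner ℝ p X with hipX
  set iup : ℝ := inner ℝ p u with hiup
  have hin1 : inner ℝ p (m • X - b • p) = m * ipX - b * P ^ 2 := by
    rw [inner_sub_right, real_inner_smul_right, real_inner_smul_right,
      real_inner_self_eq_norm_sq]
  have hin2 : inner ℝ (l • u + τ • X) ((l - κ) • X - τ • p)
      = l * (l - κ) * iuX - l * τ * iup + τ * (l - κ) * N ^ 2 - τ ^ 2 * ipX := by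
    simp only [inner_sub_right, inner_add_left, real_inner_smul_left, real_inner_smul_right,
      real_inner_self_eq_norm_sq, real_inner_comm p u, real_inner_comm p X, hiuX, hipX, hiup, hN]
    ring
  have hin3 : inner ℝ p (u + b • X) = iup + b * ipX := by
    rw [inner_add_right, real_inner_smul_right]
  have hcs1 : |ipX| ≤ P * N := abs_real_inner_le_norm _ _
  have hcs2 : |iuX| ≤ U * N := abs_real_inner_le_norm _ _
  have hnorm : U ^ 2 ≤ 2 * ‖u + b • X‖ ^ 2 + 2 * b ^ 2 * N ^ 2 := by
    have h3 : U ≤ ‖u + b • X‖ + b * N := by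
      calc U = ‖(u + b • X) - b • X‖ := by rw [add_sub_cancel_right]
        _ ≤ ‖u + b • X‖ + ‖b • X‖ := norm_sub_le _ _
        _ = _ := by rw [norm_smul, Real.norm_of_nonneg hb.le]
    have h4 : U ^ 2 ≤ (‖u + b • X‖ + b * N) ^ 2 := pow_le_pow_left₀ hU0 h3 2
    nlinarith [sq_nonneg (‖u + b • X‖ - b * N)]
  have hw : ‖l • u + τ • X‖ ≤ l * U + τ * N := by
    refine (norm_add_le _ _).trans_eq ?_
    rw [norm_smul, norm_smul, Real.norm_of_nonneg hl0.le, Real.norm_of_nonneg hτ.le]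
  rw [hin1, hin2]
  rw [hin3] at hG
  exact energy_dissipation_scalar hα hl hσ hq hτ hρ hb he hA hR hk hY he'0 he' hη' hG0 hG hm hκ
    hκα h1 h2 hU0 hcs1 hcs2 hnorm (norm_nonneg _) hw

/-! ### The energy and its majorant with frozen minimizer. -/

theorem hasDerivAt_mul_of_eq_zero {f η : ℝ → ℝ} {η' t : ℝ} (hf : ContinuousAt f t)
    (hη : HasDerivAt η η' t) (h0 : η t = 0) :
    HasDerivAt (fun s => f s * η s) (f t * η') t := by
  rw [hasDerivAt_iff_tendsto_slope] at hη ⊢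
  have h1 : Tendsto f (𝓝[≠] t) (𝓝 (f t)) := hf.tendsto.mono_left nhdsWithin_le_nhds
  -- Since `η t = 0`, the slope of the product is `f s` times the slope of `η`. Only continuity of
  -- `f` matters, which allows `f` to be a norm at one of its zeros.
  refine (h1.mul hη).congr fun s => ?_
  simp only [slope_def_field, h0]
  ring

theorem hasDerivAt_betaFun (γ β q : ℝ) {t : ℝ} (ht : 0 < t) :
    HasDerivAt (betaFun γ β q) (-(q * β * t⁻¹ / t ^ q)) t := by
  have h1 : HasDerivAt (fun s : ℝ => s ^ q) (q * t ^ (q - 1)) t :=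
    Real.hasDerivAt_rpow_const (Or.inl ht.ne')
  have hne : t ^ q ≠ 0 := (Real.rpow_pos_of_pos ht q).ne'
  have h2 := ((hasDerivAt_const t β).div h1 hne).const_add γ
  refine h2.congr_deriv ?_
  rw [Real.rpow_sub_one ht.ne']
  field_simp
  ring

section Energy

variable {H : Type*} [NormedAddCommGroup H] [InnerProductSpace ℝ H]

/-- The energy of the trajectory `x` with velocity `v`, relative to the path `z` of Tikhonov
minimizers. -/
noncomputable def energy (g : H → ℝ) (ε : ℝ → ℝ) (α β γ q : ℝ) (x v z : ℝ → H) (t : ℝ) : ℝ :=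
  (t ^ q) ^ 2 * (regObj g ε t (x t + betaFun γ β q t • v t) - regObj g ε t (z t))
    + 1 / 2 * ‖(α / 4) • (x t - z t) + t ^ q • v t‖ ^ 2
    + (α / 4 * (α - α / 4)) / 2 * ‖x t - z t‖ ^ 2

/-- A majorant of the energy to the right of `t` which is differentiable at `t`; here `zt` is the
frozen Tikhonov minimizer. -/
noncomputable def energyMajorant (g : H → ℝ) (ε : ℝ → ℝ) (α β γ q R : ℝ) (x v : ℝ → H) (zt : H)
    (t s : ℝ) : ℝ :=
  (s ^ q) ^ 2 * (regObj g ε s (x s + betaFun γ β q s • v s) - regObj g ε t zt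
      - (ε s - ε t) / 2 * R ^ 2)
    + 1 / 2 * ‖(α / 4) • (x s - zt) + s ^ q • v s‖ ^ 2
    + (α / 4) * (‖(α / 4) • (x s - zt) + s ^ q • v s‖ * (-(ε s - ε t) / ε t * R))
    + (α / 4) ^ 2 / 2 * (-(ε s - ε t) / ε t * R) ^ 2
    + (α / 4 * (α - α / 4)) / 2 * ‖x s - zt‖ ^ 2
    + (α / 4 * (α - α / 4)) * (‖x s - zt‖ * (-(ε s - ε t) / ε t * R))
    + (α / 4 * (α - α / 4)) / 2 * (-(ε s - ε t) / ε t * R) ^ 2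

theorem energyMajorant_self (g : H → ℝ) (ε : ℝ → ℝ) (α β γ q R : ℝ) (x v z : ℝ → H) (t : ℝ) :
    energyMajorant g ε α β γ q R x v (z t) t t = energy g ε α β γ q x v z t := by
  simp [energyMajorant, energy]

theorem half_norm_sub_sq_le {w d : H} {l η : ℝ} (hl : 0 ≤ l) (hd : ‖d‖ ≤ η) :
    1 / 2 * ‖w - l • d‖ ^ 2 ≤ 1 / 2 * ‖w‖ ^ 2 + l * (‖w‖ * η) + l ^ 2 / 2 * η ^ 2 := by
  have h1 : ‖w - l • d‖ ≤ ‖w‖ + l * η := by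
    refine (norm_sub_le _ _).trans ?_
    rw [norm_smul, Real.norm_of_nonneg hl]
    gcongr
  have h2 := pow_le_pow_left₀ (norm_nonneg _) h1 2
  linarith

variable [CompleteSpace H] {g : H → ℝ}

/-- Freezing the minimizer costs at most `η = (ε t - ε s) / ε t * R` in each norm. The optimal
values are compared by testing the minimality of `z t` at `z s`. -/
theorem energy_le_energyMajorant (hg : ConvexOn ℝ univ g) (hd : Differentiable ℝ g) {ε : ℝ → ℝ}
    {α β γ q R : ℝ} (hα : 0 < α) (x v : ℝ → H) {z : ℝ → H} {s t : ℝ} (hs : 0 < ε s)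
    (hst : ε s ≤ ε t)
    (hzs : IsMinimizer (regObj g ε s) (z s)) (hzt : IsMinimizer (regObj g ε t) (z t))
    (hR : ‖z s‖ ≤ R) :
    energy g ε α β γ q x v z s ≤ energyMajorant g ε α β γ q R x v (z t) t s := by
  have ht : 0 < ε t := hs.trans_le hst
  have hd1 : ‖z s - z t‖ ≤ -(ε s - ε t) / ε t * R := by
    refine (norm_minimizer_regObj_sub_le hg hd ht hzt hzs).trans ?_
    rw [abs_of_nonneg (by linarith), neg_sub]
    have : 0 ≤ (ε t - ε s) / ε t := div_nonneg (by linarith) ht.le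
    gcongr
  have h1 := half_norm_sub_sq_le (w := (α / 4) • (x s - z t) + s ^ q • v s) (l := α / 4)
    (by positivity) hd1
  have h2 := half_norm_sub_sq_le (w := x s - z t) zero_le_one hd1
  have e1 : (α / 4) • (x s - z t) + s ^ q • v s - (α / 4) • (z s - z t)
      = (α / 4) • (x s - z s) + s ^ q • v s := by
    simp only [smul_sub]; abel
  have e2 : x s - z t - (1 : ℝ) • (z s - z t) = x s - z s := by
    rw [one_smul]; abel
  rw [e1] at h1
  rw [e2] at h2
  have h3 : - regObj g ε s (z s) ≤ - regObj g ε t (z t) - (ε s - ε t) / 2 * R ^ 2 := by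
    have h4 := hzt (z s)
    have h5 : (ε t - ε s) / 2 * ‖z s‖ ^ 2 ≤ (ε t - ε s) / 2 * R ^ 2 := by
      have : 0 ≤ (ε t - ε s) / 2 := by linarith
      gcongr
    simp only [regObj] at h4 ⊢
    linarith
  have hσ : 0 < α / 4 * (α - α / 4) := by nlinarith
  have h6 := mul_le_mul_of_nonneg_left h2 hσ.le
  have h7 := mul_le_mul_of_nonneg_left h3 (sq_nonneg (s ^ q))
  simp only [energy, energyMajorant]
  linarith

theorem hasDerivAt_energyMajorant (hd : Differentiable ℝ g) {ε : ℝ → ℝ}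
    {α β γ q R e' t : ℝ} {x v : ℝ → H} {a zt : H} (ht : 0 < t)
    (hx : HasDerivAt x (v t) t) (hv : HasDerivAt v a t) (hε : HasDerivAt ε e' t)
    (heq : a + (α / t ^ q) • v t + gradient g (x t + betaFun γ β q t • v t) + ε t • x t = 0) :
    HasDerivAt (energyMajorant g ε α β γ q R x v zt t)
      (2 * q * (t ^ q) ^ 2 * t⁻¹
          * (regObj g ε t (x t + betaFun γ β q t • v t) - regObj g ε t zt)
        + (t ^ q) ^ 2 * (inner ℝ (gradient g (x t + betaFun γ β q t • v t)
              + ε t • (x t + betaFun γ β q t • v t))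
            ((1 + -(q * β * t⁻¹ / t ^ q) - α * betaFun γ β q t / t ^ q
                + ε t * betaFun γ β q t ^ 2) • v t
              - betaFun γ β q t • (gradient g (x t + betaFun γ β q t • v t)
                + ε t • (x t + betaFun γ β q t • v t)))
            + e' / 2 * ‖x t + betaFun γ β q t • v t‖ ^ 2 - e' / 2 * R ^ 2)
        + inner ℝ ((α / 4) • (x t - zt) + t ^ q • v t)
            ((α / 4 - (α - q * t ^ q * t⁻¹ - t ^ q * ε t * betaFun γ β q t)) • v t
              - t ^ q • (gradient g (x t + betaFun γ β q t • v t)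
                + ε t • (x t + betaFun γ β q t • v t)))
        + α / 4 * (‖(α / 4) • (x t - zt) + t ^ q • v t‖ * (-e' / ε t * R))
        + α / 4 * (α - α / 4) * (inner ℝ (x t - zt) (v t) + ‖x t - zt‖ * (-e' / ε t * R))) t := by
  have hτ : HasDerivAt (fun s : ℝ => s ^ q) (q * t ^ q * t⁻¹) t := by
    refine (Real.hasDerivAt_rpow_const (Or.inl ht.ne')).congr_deriv ?_
    rw [Real.rpow_sub_one ht.ne']
    field_simp
  have hτ0 : t ^ q ≠ 0 := (Real.rpow_pos_of_pos ht q).ne'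
  set b := betaFun γ β q t with hb
  set y : ℝ → H := fun s => x s + betaFun γ β q s • v s with hy
  have hyt : x t + b • v t = y t := rfl
  rw [hyt] at heq ⊢
  set p := gradient g (y t) + ε t • y t with hp
  -- The equation damps with `ε x`, whereas `p` contains `ε y`; the difference `ε b v` reduces the
  -- effective friction.
  have ha : a = -(α / t ^ q) • v t - p + (ε t * b) • v t := by
    have h1 : a = -((α / t ^ q) • v t + gradient g (y t) + ε t • x t) := by
      rw [← sub_eq_zero, sub_neg_eq_add, ← heq]; abel
    rw [h1, hp, ← hyt, smul_add, smul_smul, neg_smul]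
    abel
  have hy' : HasDerivAt y ((1 + -(q * β * t⁻¹ / t ^ q) - α * b / t ^ q + ε t * b ^ 2) • v t
      - b • p) t := by
    refine (hx.add ((hasDerivAt_betaFun γ β q ht).smul hv)).congr_deriv ?_
    rw [ha, ← hb]
    module
  have hgy : HasDerivAt (fun s => g (y s)) (inner ℝ (gradient g (y t))
      ((1 + -(q * β * t⁻¹ / t ^ q) - α * b / t ^ q + ε t * b ^ 2) • v t - b • p)) t := by
    rw [inner_gradient_left]
    exact (hd (y t)).hasFDerivAt.comp_hasDerivAt t hy'
  have hreg : HasDerivAt (fun s => regObj g ε s (y s)) (inner ℝ p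
      ((1 + -(q * β * t⁻¹ / t ^ q) - α * b / t ^ q + ε t * b ^ 2) • v t - b • p)
      + e' / 2 * ‖y t‖ ^ 2) t := by
    refine (hgy.add ((hε.div_const 2).mul hy'.norm_sq)).congr_deriv ?_
    rw [hp, inner_add_left (gradient g (y t)) (ε t • y t), real_inner_smul_left (y t)]
    ring
  have hη : HasDerivAt (fun s => -(ε s - ε t) / ε t * R) (-e' / ε t * R) t :=
    (((hε.sub_const (ε t)).neg).div_const (ε t)).mul_const R
  have hu : HasDerivAt (fun s => x s - zt) (v t) t := hx.sub_const zt
  have hw : HasDerivAt (fun s => (α / 4) • (x s - zt) + s ^ q • v s)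
      ((α / 4 - (α - q * t ^ q * t⁻¹ - t ^ q * ε t * b)) • v t - t ^ q • p) t := by
    refine ((hu.const_smul (α / 4)).add (hτ.smul hv)).congr_deriv ?_
    rw [ha]
    have : t ^ q * (α / t ^ q) = α := by field_simp
    simp only [smul_add, smul_sub, smul_smul, mul_neg, this]
    module
  have hη0 : -(ε t - ε t) / ε t * R = 0 := by simp
  have h1 := ((hτ.pow 2).mul ((hreg.sub_const (regObj g ε t zt)).sub
    (((hε.sub_const (ε t)).div_const 2).mul_const (R ^ 2))))
  have h2 := hw.norm_sq.const_mul (1 / 2)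
  have h3 := (hasDerivAt_mul_of_eq_zero hw.continuousAt.norm hη hη0).const_mul (α / 4)
  have h4 := (hη.pow 2).const_mul ((α / 4) ^ 2 / 2)
  have h5 := hu.norm_sq.const_mul ((α / 4 * (α - α / 4)) / 2)
  have h6 := (hasDerivAt_mul_of_eq_zero hu.continuousAt.norm hη hη0).const_mul
    (α / 4 * (α - α / 4))
  have h7 := (hη.pow 2).const_mul ((α / 4 * (α - α / 4)) / 2)
  refine ((((((h1.add h2).add h3).add h4).add h5).add h6).add h7).congr_deriv ?_
  simp only [Pi.sub_apply, Pi.pow_apply]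
  ring

end Energy

/-! ### Asymptotics of the coefficients. -/

/-- The standing assumptions on the parameters and on the Tikhonov coefficient. -/
structure Admissible (α β γ q r t₀ : ℝ) (ε : ℝ → ℝ) : Prop where
  α_pos : 0 < α
  q_pos : 0 < q
  q_lt_one : q < 1
  t₀_pos : 0 < t₀
  gamma_beta : 0 < γ ∨ (γ = 0 ∧ 0 < β)
  beta_neg : β < 0 → |β / γ| ^ (1 / q) < t₀
  smooth : ContDiffOn ℝ 1 ε (Ici t₀)
  anti : AntitoneOn ε (Ici t₀)
  lim : Tendsto ε atTop (𝓝 0)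
  q_lt_r : q < r
  r_lt_one : r < 1
  lower : ∃ K₁ : ℝ, 0 < K₁ ∧ ∀ᶠ t in atTop, K₁ / t ^ (r + q) ≤ ε t
  upper : γ ≠ 0 → ∀ᶠ t in atTop, ε t ≤ α / (2 * γ * t ^ q)
  log_deriv : ∃ K₃ : ℝ, 0 < K₃ ∧ ∀ᶠ t in atTop, (deriv ε t / ε t) ^ 2 ≤ K₃ / t ^ 2

namespace Admissible

variable {α β γ q r t₀ : ℝ} {ε : ℝ → ℝ} (h : Admissible α β γ q r t₀ ε)

include h

/-- The lower bound on `ε` holds only for large times; monotonicity carries positivity back to `t₀`.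
-/
theorem ε_pos : ∀ t ∈ Ici t₀, 0 < ε t := fun t ht => by
  obtain ⟨K, hK, hl⟩ := h.lower
  obtain ⟨s, hs, hst, hs0⟩ := (hl.and ((eventually_ge_atTop t).and (eventually_gt_atTop 0))).exists
  have h1 : 0 < K / s ^ (r + q) := div_pos hK (Real.rpow_pos_of_pos hs0 _)
  exact (h1.trans_le hs).trans_le (h.anti ht (le_trans ht hst) hst)

theorem beta_pos : ∀ t ∈ Ici t₀, 0 < betaFun γ β q t := fun t ht => by
  have ht0 : 0 < t := h.t₀_pos.trans_le ht
  have hτ : 0 < t ^ q := Real.rpow_pos_of_pos ht0 q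
  unfold betaFun
  rcases h.gamma_beta with hγ | ⟨hγ, hβ⟩
  · rcases le_or_gt 0 β with hβ | hβ
    · have : 0 ≤ β / t ^ q := div_nonneg hβ hτ.le
      linarith
    · have h1 : |β / γ| < t ^ q := by
        have h2 : |β / γ| ^ (1 / q) < t := (h.beta_neg hβ).trans_le ht
        have h3 := Real.rpow_lt_rpow (Real.rpow_nonneg (abs_nonneg _) _) h2 h.q_pos
        rwa [← Real.rpow_mul (abs_nonneg _), one_div_mul_cancel h.q_pos.ne', Real.rpow_one] at h3
      rw [abs_div, abs_of_neg hβ, abs_of_pos hγ, div_lt_iff₀ hγ] at h1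
      have h2 : γ + β / t ^ q = (t ^ q * γ + β) / t ^ q := by field_simp
      rw [h2]
      exact div_pos (by linarith) hτ
  · rw [hγ, zero_add]
    exact div_pos hβ hτ

theorem tendsto_rpow_q : Tendsto (fun t : ℝ => t ^ q) atTop atTop := tendsto_rpow_atTop h.q_pos

theorem tendsto_beta : Tendsto (betaFun γ β q) atTop (𝓝 γ) := by
  have h1 := h.tendsto_rpow_q.const_div_atTop β
  have h2 := h1.const_add γ
  rwa [add_zero] at h2

theorem tendsto_rpow_q_mul_inv : Tendsto (fun t : ℝ => t ^ q * t⁻¹) atTop (𝓝 0) := by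
  have h1 : 0 < 1 - q := sub_pos.2 h.q_lt_one
  refine (tendsto_rpow_neg_atTop h1).congr' ?_
  filter_upwards [eventually_gt_atTop 0] with t ht
  rw [← Real.rpow_neg_one t, ← Real.rpow_add ht]
  congr 1; ring

theorem tendsto_inv_sq_div_ε : Tendsto (fun t : ℝ => t⁻¹ ^ 2 / ε t) atTop (𝓝 0) := by
  obtain ⟨K, hK, hl⟩ := h.lower
  have h1 : 0 < 2 - (r + q) := by linarith [h.r_lt_one, h.q_lt_one]
  have h2 := (tendsto_rpow_neg_atTop h1).const_mul (1 / K)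
  rw [mul_zero] at h2
  refine squeeze_zero' ?_ ?_ h2
  · filter_upwards [eventually_ge_atTop t₀] with t ht
    have := h.ε_pos t ht
    positivity
  · filter_upwards [hl, eventually_gt_atTop 0] with t ht ht0
    have h3 : 0 < t ^ (r + q) := Real.rpow_pos_of_pos ht0 _
    calc t⁻¹ ^ 2 / ε t ≤ t⁻¹ ^ 2 / (K / t ^ (r + q)) := by gcongr
      _ = 1 / K * (t ^ (r + q) * t⁻¹ ^ 2) := by field_simp
      _ = 1 / K * t ^ (-(2 - (r + q))) := by
        congr 1
        rw [neg_sub, Real.rpow_sub ht0, Real.rpow_two]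
        field_simp

/-- For `γ > 0` the upper bound on `ε` gives `α/2` at the limit value `γ`, and the factor `9/8`
leaves room for `β(t) → γ` from above. For `γ = 0` the product is `β ε t`, which tends to `0`. -/
theorem eventually_rpow_mul_ε_mul_beta_le :
    ∀ᶠ t in atTop, t ^ q * ε t * betaFun γ β q t ≤ 9 * α / 16 := by
  have hα := h.α_pos
  rcases h.gamma_beta with hγ | ⟨hγ, hβ⟩
  · have h1 : ∀ᶠ t in atTop, betaFun γ β q t < 9 / 8 * γ :=
      h.tendsto_beta.eventually (gt_mem_nhds (by linarith))
    filter_upwards [h.upper hγ.ne', h1, eventually_ge_atTop t₀] with t h2 h3 ht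
    have ht0 : 0 < t := h.t₀_pos.trans_le ht
    have hτ : 0 < t ^ q := Real.rpow_pos_of_pos ht0 q
    have hb := h.beta_pos t ht
    calc t ^ q * ε t * betaFun γ β q t ≤ t ^ q * (α / (2 * γ * t ^ q)) * (9 / 8 * γ) := by gcongr
      _ = 9 * α / 16 := by field_simp; norm_num
  · have h1 : Tendsto (fun t => ε t * β) atTop (𝓝 0) := by simpa using h.lim.mul_const β
    filter_upwards [h1.eventually (gt_mem_nhds (by positivity : 0 < 9 * α / 16)),
      eventually_gt_atTop 0] with t h2 ht
    have hτ : 0 < t ^ q := Real.rpow_pos_of_pos ht q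
    refine le_of_eq_of_le ?_ h2.le
    rw [betaFun, hγ, zero_add]
    field_simp

theorem eventually_abs_beta_deriv_le :
    ∀ᶠ t in atTop, q * |β| * t⁻¹ ≤ betaFun γ β q t := by
  rcases h.gamma_beta with hγ | ⟨hγ, hβ⟩
  · have h1 : Tendsto (fun t : ℝ => q * |β| * t⁻¹) atTop (𝓝 0) := by
      simpa using tendsto_inv_atTop_zero.const_mul (q * |β|)
    have h2 : ∀ᶠ t in atTop, γ / 2 < betaFun γ β q t :=
      h.tendsto_beta.eventually (lt_mem_nhds (by linarith))
    filter_upwards [h1.eventually (gt_mem_nhds (by positivity : 0 < γ / 2)), h2] with t h3 h4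
    linarith
  · filter_upwards [h.tendsto_rpow_q_mul_inv.eventually (gt_mem_nhds one_pos),
      eventually_gt_atTop 0] with t h3 ht
    have hτ : 0 < t ^ q := Real.rpow_pos_of_pos ht q
    rw [betaFun, hγ, zero_add, le_div_iff₀ hτ, abs_of_pos hβ]
    have hq := h.q_lt_one
    have hq0 := h.q_pos
    have h4 : q * (t ^ q * t⁻¹) ≤ 1 := by
      have : 0 ≤ t ^ q * t⁻¹ := by positivity
      nlinarith
    calc q * β * t⁻¹ * t ^ q = β * (q * (t ^ q * t⁻¹)) := by ring
      _ ≤ β * 1 := by gcongr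
      _ = β := mul_one β

/-- The three deviations of the coefficient from `1`, multiplied by `t ^ q`, are at most `b`, `α b`
and `9α/16 b`, where `b = β(t)`. This proportionality to `b` lets the gradient term absorb the cross
term even when `β(t) → 0`. -/
theorem eventually_abs_coeff_le :
    ∀ᶠ t in atTop, |(1 + -(q * β * t⁻¹ / t ^ q) - α * betaFun γ β q t / t ^ q
      + ε t * betaFun γ β q t ^ 2) - 1| * t ^ q ≤ (1 + 2 * α) * betaFun γ β q t := by
  have hα := h.α_pos
  filter_upwards [h.eventually_rpow_mul_ε_mul_beta_le, h.eventually_abs_beta_deriv_le,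
    eventually_ge_atTop t₀] with t h1 h2 ht
  have ht0 : 0 < t := h.t₀_pos.trans_le ht
  have hτ : 0 < t ^ q := Real.rpow_pos_of_pos ht0 q
  have hb := h.beta_pos t ht
  have he := h.ε_pos t ht
  have hq0 := h.q_pos
  set b := betaFun γ β q t
  have h3 : |(1 + -(q * β * t⁻¹ / t ^ q) - α * b / t ^ q + ε t * b ^ 2) - 1| * t ^ q
      = |-(q * β * t⁻¹) - α * b + (t ^ q * ε t * b) * b| := by
    rw [← abs_of_pos hτ, ← abs_mul, abs_of_pos hτ]
    congr 1
    field_simp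
    ring
  rw [h3]
  have h4 : |q * β * t⁻¹| ≤ b := by
    rwa [abs_mul, abs_mul, abs_of_pos hq0, abs_of_pos (inv_pos.2 ht0)]
  have h5 := abs_le.1 h4
  have h6 : (t ^ q * ε t * b) * b ≤ 9 * α / 16 * b := by gcongr
  have h7 : 0 ≤ (t ^ q * ε t * b) * b := by positivity
  have h8 : 0 ≤ α * b := by positivity
  rw [abs_le]
  constructor <;> linarith [h5.1, h5.2]

/-- `3α/8 = α - 9α/16 - α/16` exceeds `l = α/4`, so friction survives the loss caused by `l`. -/
theorem eventually_friction_ge :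
    ∀ᶠ t in atTop, 3 * α / 8 ≤ α - q * t ^ q * t⁻¹ - t ^ q * ε t * betaFun γ β q t := by
  have hα := h.α_pos
  have h1 : Tendsto (fun t : ℝ => q * (t ^ q * t⁻¹)) atTop (𝓝 0) := by
    simpa using h.tendsto_rpow_q_mul_inv.const_mul q
  filter_upwards [h.eventually_rpow_mul_ε_mul_beta_le,
    h1.eventually (gt_mem_nhds (by positivity : 0 < α / 16))] with t h2 h3
  linarith

theorem eventually_potential_coeff_le :
    ∀ᶠ t : ℝ in atTop, 2 * q * t ^ q * t⁻¹ ≤ α / 8 := by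
  have hα := h.α_pos
  have h1 : Tendsto (fun t : ℝ => 2 * q * (t ^ q * t⁻¹)) atTop (𝓝 0) := by
    simpa using h.tendsto_rpow_q_mul_inv.const_mul (2 * q)
  filter_upwards [h1.eventually (gt_mem_nhds (by positivity : 0 < α / 8))] with t h3
  linarith

theorem eventually_kinetic_coeff_le (A l : ℝ) :
    ∀ᶠ t in atTop, (A + l) ^ 2 * betaFun γ β q t / 2
      + 9 / 2 * l * t ^ q * ε t * betaFun γ β q t ^ 2
      + 4 * l * q ^ 2 * t ^ q * (t⁻¹ ^ 2 / ε t) ≤ α / 32 * t ^ q := by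
  have hα := h.α_pos
  have h1 : Tendsto (fun t => (A + l) ^ 2 / 2 * (betaFun γ β q t / t ^ q)
      + 9 / 2 * l * (ε t * betaFun γ β q t ^ 2) + 4 * l * q ^ 2 * (t⁻¹ ^ 2 / ε t)) atTop (𝓝 0) := by
    have := (((h.tendsto_beta.div_atTop h.tendsto_rpow_q).const_mul ((A + l) ^ 2 / 2)).add
      ((h.lim.mul (h.tendsto_beta.pow 2)).const_mul (9 / 2 * l))).add
      (h.tendsto_inv_sq_div_ε.const_mul (4 * l * q ^ 2))
    simpa using this
  filter_upwards [h1.eventually (gt_mem_nhds (by positivity : 0 < α / 32)),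
    eventually_gt_atTop 0] with t h2 ht
  have hτ : 0 < t ^ q := Real.rpow_pos_of_pos ht q
  have h3 := mul_le_mul_of_nonneg_right h2.le hτ.le
  refine le_of_eq_of_le ?_ h3
  field_simp

theorem hasDerivAt_ε {t : ℝ} (ht : t₀ < t) : HasDerivAt ε (deriv ε t) t :=
  (((h.smooth.differentiableOn one_ne_zero) t ht.le).differentiableAt
    (Ici_mem_nhds ht)).hasDerivAt

theorem deriv_ε_nonpos {t : ℝ} (ht : t₀ < t) : deriv ε t ≤ 0 := by
  have h1 := (h.hasDerivAt_ε ht).hasDerivWithinAt (s := Ici t₀)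
  rw [← derivWithin_of_mem_nhds (Ici_mem_nhds ht)]
  exact h.anti.derivWithin_nonpos

theorem exists_neg_deriv_ε_le :
    ∃ k, 0 ≤ k ∧ ∀ᶠ t in atTop, -deriv ε t ≤ k * t⁻¹ * ε t := by
  obtain ⟨K, hK, hl⟩ := h.log_deriv
  refine ⟨√K, Real.sqrt_nonneg K, ?_⟩
  filter_upwards [hl, eventually_ge_atTop t₀] with t h1 ht
  have ht0 : 0 < t := h.t₀_pos.trans_le ht
  have he := h.ε_pos t ht
  have h2 : K / t ^ 2 = (√K / t) ^ 2 := by rw [div_pow, Real.sq_sqrt hK.le]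
  rw [h2] at h1
  have h3 := (abs_le_of_sq_le_sq' h1 (by positivity)).1
  have h4 : -(√K / t) * ε t ≤ deriv ε t := (le_div_iff₀ he).1 h3
  rw [← div_eq_mul_inv]
  linarith

/-- The lower bound on `ε` in its two uses: comparing the dissipation with the energy, and bounding
the error left by Young's inequality. -/
theorem eventually_inv_sq_div_le : ∃ K, 0 < K ∧
    ∀ᶠ t in atTop, t ^ (-r) ≤ K * (t ^ q * ε t) ∧ t⁻¹ ^ 2 / (t ^ q * ε t) ≤ K * t ^ (r - 2) := by
  obtain ⟨K, hK, hl⟩ := h.lower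
  refine ⟨1 / K, by positivity, ?_⟩
  filter_upwards [hl, eventually_ge_atTop t₀] with t h1 ht
  have ht0 : 0 < t := h.t₀_pos.trans_le ht
  have hτ : 0 < t ^ q := Real.rpow_pos_of_pos ht0 q
  have hr : 0 < t ^ r := Real.rpow_pos_of_pos ht0 r
  have he := h.ε_pos t ht
  rw [Real.rpow_add ht0, div_le_iff₀ (by positivity)] at h1
  rw [Real.rpow_neg ht0.le, Real.rpow_sub ht0, Real.rpow_two]
  constructor
  · rw [one_div_mul_eq_div, inv_eq_one_div, div_le_div_iff₀ hr hK]
    linarith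
  · rw [inv_pow, one_div_mul_eq_div, div_div, inv_eq_one_div, div_div, div_le_div_iff₀ (by positivity) (by positivity)]
    nlinarith [sq_nonneg t]

end Admissible

/-! ### The differential inequality along a trajectory. -/

section Decay

variable {H : Type*} [NormedAddCommGroup H] [InnerProductSpace ℝ H] [CompleteSpace H]

/-- A trajectory `x` with continuous velocity `v`, the path `z` of Tikhonov minimizers and a
minimizer `xs` of `g`. -/
structure Trajectory (g : H → ℝ) (ε : ℝ → ℝ) (α β γ q r t₀ : ℝ) (x v z : ℝ → H) (xs : H) :
    Prop where
  convex : ConvexOn ℝ univ g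
  diff : Differentiable ℝ g
  grad_cont : Continuous (gradient g)
  params : Admissible α β γ q r t₀ ε
  x_cont : ContinuousOn x (Ici t₀)
  v_cont : ContinuousOn v (Ici t₀)
  x_deriv : ∀ t, t₀ < t → HasDerivAt x (v t) t
  v_deriv : ∀ t, t₀ < t → ∃ a, HasDerivAt v a t ∧
    a + (α / t ^ q) • v t + gradient g (x t + betaFun γ β q t • v t) + ε t • x t = 0
  z_min : ∀ t ∈ Ici t₀, IsMinimizer (regObj g ε t) (z t)
  xs_min : IsMinimizer g xs

/-- The dissipation rate of the energy. -/
noncomputable def dissipation (g : H → ℝ) (ε : ℝ → ℝ) (α β γ q : ℝ) (x v z : ℝ → H) (t : ℝ) : ℝ :=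
  α / 8 * t ^ q * (regObj g ε t (x t + betaFun γ β q t • v t) - regObj g ε t (z t))
    + α / 32 * t ^ q * ‖v t‖ ^ 2
    + 1 / 2 * (t ^ q) ^ 2 * betaFun γ β q t
      * ‖gradient g (x t + betaFun γ β q t • v t)
          + ε t • (x t + betaFun γ β q t • v t)‖ ^ 2
    + α / 64 * t ^ q * ε t * ‖x t - z t‖ ^ 2

/-- The forcing term in the differential inequality for the energy. -/
noncomputable def forcing (ε : ℝ → ℝ) (q r t : ℝ) : ℝ := t ^ (r - 2) + t ^ (2 * q - 1) * ε t

namespace Trajectory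

variable {g : H → ℝ} {ε : ℝ → ℝ} {α β γ q r t₀ : ℝ} {x v z : ℝ → H} {xs : H}
  (h : Trajectory g ε α β γ q r t₀ x v z xs)

include h

theorem pos {t : ℝ} (ht : t ∈ Ici t₀) : 0 < t := h.params.t₀_pos.trans_le ht

theorem norm_z_le {t : ℝ} (ht : t ∈ Ici t₀) : ‖z t‖ ≤ ‖xs‖ :=
  norm_minimizer_regObj_le (h.params.ε_pos t ht) (h.z_min t ht) h.xs_min

theorem gap_nonneg {t : ℝ} (ht : t ∈ Ici t₀) (y : H) : 0 ≤ regObj g ε t y - regObj g ε t (z t) :=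
  sub_nonneg.2 (h.z_min t ht y)

theorem ε_cont : ContinuousOn ε (Ici t₀) := h.params.smooth.continuousOn

theorem z_cont : ContinuousOn z (Ici t₀) := by
  intro t ht
  have he := h.params.ε_pos t ht
  rw [ContinuousWithinAt, tendsto_iff_norm_sub_tendsto_zero]
  have h1 : Tendsto (fun s => |ε t - ε s| / ε t * ‖xs‖) (𝓝[Ici t₀] t) (𝓝 0) := by
    have h2 : Tendsto (fun s => ε t - ε s) (𝓝[Ici t₀] t) (𝓝 (ε t - ε t)) :=
      tendsto_const_nhds.sub (h.ε_cont t ht)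
    simpa using (h2.abs.div_const (ε t)).mul_const ‖xs‖
  refine squeeze_zero' (Eventually.of_forall fun _ => norm_nonneg _) ?_ h1
  filter_upwards [self_mem_nhdsWithin] with s hs
  refine (norm_minimizer_regObj_sub_le h.convex h.diff he (h.z_min t ht) (h.z_min s hs)).trans ?_
  have := h.norm_z_le hs
  gcongr

theorem rpow_cont (a : ℝ) : ContinuousOn (fun t : ℝ => t ^ a) (Ici t₀) := fun _ ht =>
  (Real.continuousAt_rpow_const _ _ (Or.inl (h.pos ht).ne')).continuousWithinAt

theorem beta_cont : ContinuousOn (betaFun γ β q) (Ici t₀) :=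
  continuousOn_const.add (continuousOn_const.div (h.rpow_cont q)
    fun _ ht => (Real.rpow_pos_of_pos (h.pos ht) q).ne')

theorem y_cont : ContinuousOn (fun t => x t + betaFun γ β q t • v t) (Ici t₀) :=
  h.x_cont.add (h.beta_cont.smul h.v_cont)

theorem gap_cont : ContinuousOn (fun t => regObj g ε t (x t + betaFun γ β q t • v t)
    - regObj g ε t (z t)) (Ici t₀) := by
  have h1 := h.diff.continuous.comp_continuousOn h.y_cont
  have h2 := h.diff.continuous.comp_continuousOn h.z_cont
  exact (h1.add ((h.ε_cont.div_const 2).mul (h.y_cont.norm.pow 2))).sub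
    (h2.add ((h.ε_cont.div_const 2).mul (h.z_cont.norm.pow 2)))

theorem grad_y_cont :
    ContinuousOn (fun t => gradient g (x t + betaFun γ β q t • v t)) (Ici t₀) :=
  h.grad_cont.comp_continuousOn h.y_cont

theorem energy_cont : ContinuousOn (energy g ε α β γ q x v z) (Ici t₀) := by
  have h1 := (h.x_cont.sub h.z_cont).const_smul (α / 4)
  have h2 := (h.rpow_cont q).smul h.v_cont
  exact ((((h.rpow_cont q).pow 2).mul h.gap_cont).add
    (((h1.add h2).norm.pow 2).const_mul (1 / 2))).add
    (((h.x_cont.sub h.z_cont).norm.pow 2).const_mul ((α / 4 * (α - α / 4)) / 2))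

theorem dissipation_cont : ContinuousOn (dissipation g ε α β γ q x v z) (Ici t₀) := by
  have hτ := h.rpow_cont q
  have hu := (h.x_cont.sub h.z_cont).norm.pow 2
  have hp := (h.grad_y_cont.add (h.ε_cont.smul h.y_cont)).norm.pow 2
  exact ((((hτ.const_mul (α / 8)).mul h.gap_cont).add
    ((hτ.const_mul (α / 32)).mul (h.v_cont.norm.pow 2))).add
    ((((hτ.pow 2).const_mul (1 / 2)).mul h.beta_cont).mul hp)).add
    (((hτ.const_mul (α / 64)).mul h.ε_cont).mul hu)

theorem forcing_cont : ContinuousOn (forcing ε q r) (Ici t₀) :=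
  (h.rpow_cont (r - 2)).add ((h.rpow_cont (2 * q - 1)).mul h.ε_cont)

theorem forcing_pos {t : ℝ} (ht : t ∈ Ici t₀) : 0 < forcing ε q r t := by
  have h1 := Real.rpow_pos_of_pos (h.pos ht) (r - 2)
  have h2 := Real.rpow_pos_of_pos (h.pos ht) (2 * q - 1)
  have h3 := h.params.ε_pos t ht
  unfold forcing
  positivity

theorem dissipation_parts_nonneg {t : ℝ} (ht : t ∈ Ici t₀) :
    0 ≤ α / 8 * t ^ q * (regObj g ε t (x t + betaFun γ β q t • v t) - regObj g ε t (z t)) ∧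
    0 ≤ α / 32 * t ^ q * ‖v t‖ ^ 2 ∧
    0 ≤ 1 / 2 * (t ^ q) ^ 2 * betaFun γ β q t
      * ‖gradient g (x t + betaFun γ β q t • v t)
          + ε t • (x t + betaFun γ β q t • v t)‖ ^ 2 ∧
    0 ≤ α / 64 * t ^ q * ε t * ‖x t - z t‖ ^ 2 := by
  have hτ := Real.rpow_pos_of_pos (h.pos ht) q
  have hα := h.params.α_pos
  have he := h.params.ε_pos t ht
  have hb := h.params.beta_pos t ht
  have hG := h.gap_nonneg ht (x t + betaFun γ β q t • v t)
  refine ⟨?_, ?_, ?_, ?_⟩ <;> positivity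

/-- This says that the upper right Dini derivative of the energy is at most `-D + C F`. Slopes of
the energy lie below those of the majorant, which agrees with it at `t`, and `energy_dissipation`
bounds the derivative of the majorant. -/
theorem energy_slope_lt : ∃ C, 0 ≤ C ∧ ∀ᶠ t in atTop, ∀ ρ,
    -dissipation g ε α β γ q x v z t + C * forcing ε q r t < ρ →
      ∀ᶠ s in 𝓝[>] t, slope (energy g ε α β γ q x v z) t s < ρ := by
  have hα := h.params.α_pos
  obtain ⟨k, hk, hk'⟩ := h.params.exists_neg_deriv_ε_le
  obtain ⟨K, hK, hK'⟩ := h.params.eventually_inv_sq_div_le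
  set l := α / 4 with hl
  set σ := l * (α - l) with hσ
  have hl0 : 0 < l := by positivity
  have hσ0 : 0 < σ := by rw [hσ, hl]; nlinarith
  set R := ‖xs‖ with hR
  refine ⟨k * R ^ 2 / 2 + 4 * ((l ^ 2 + σ) * k * R) ^ 2 / l * K + 4 * (l * k * R) ^ 2 / α,
    by positivity, ?_⟩
  filter_upwards [hk', hK', h.params.eventually_abs_coeff_le, h.params.eventually_friction_ge,
    h.params.eventually_potential_coeff_le,
    h.params.eventually_kinetic_coeff_le (1 + 2 * α) l, eventually_gt_atTop t₀,
    eventually_ge_atTop 1] with t h1 h2 h3 h4 h5 h6 ht ht1 ρ hρ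
  have ht' : t ∈ Ici t₀ := ht.le
  have ht0 : 0 < t := h.pos ht'
  have hτ : 0 < t ^ q := Real.rpow_pos_of_pos ht0 q
  have he := h.params.ε_pos t ht'
  have hb := h.params.beta_pos t ht'
  obtain ⟨a, ha, heq⟩ := h.v_deriv t ht
  have hder := hasDerivAt_energyMajorant (R := R) (zt := z t) h.diff ht0 (h.x_deriv t ht) ha
    (h.params.hasDerivAt_ε ht) heq
  have he'0 := h.params.deriv_ε_nonpos ht
  have hη : -deriv ε t / ε t * R ≤ k * t⁻¹ * R := by
    have : -deriv ε t / ε t ≤ k * t⁻¹ := (div_le_iff₀ he).2 h1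
    gcongr
  have hG : regObj g ε t (x t + betaFun γ β q t • v t) - regObj g ε t (z t)
      + ε t / 2 * ‖(x t - z t) + betaFun γ β q t • v t‖ ^ 2
      ≤ inner ℝ (gradient g (x t + betaFun γ β q t • v t)
          + ε t • (x t + betaFun γ β q t • v t)) ((x t - z t) + betaFun γ β q t • v t) := by
    have h7 := regObj_gradient_le h.convex h.diff (ε t) (x t + betaFun γ β q t • v t) (z t)
    have h8 : x t - z t + betaFun γ β q t • v t
        = -(z t - (x t + betaFun γ β q t • v t)) := by abel
    rw [h8, inner_neg_right, norm_neg]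
    simp only [regObj]
    linarith
  have hdis := energy_dissipation (α := α) (q := q) (τ := t ^ q) (ρ := t⁻¹)
    (b := betaFun γ β q t) (e := ε t) (e' := deriv ε t) (k := k) (R := R) (A := 1 + 2 * α)
    (l := l) (σ := σ) (η' := -deriv ε t / ε t * R)
    (Y := ‖x t + betaFun γ β q t • v t‖ ^ 2) hα hl hσ h.params.q_pos hτ (inv_pos.2 ht0)
    hb he (by positivity) (norm_nonneg _) hk (sq_nonneg _) he'0 h1 hη
    (h.gap_nonneg ht' _) hG h3 rfl h4 h5 h6
  have hforce : k * R ^ 2 / 2 * ((t ^ q) ^ 2 * t⁻¹ * ε t)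
        + 4 * ((l ^ 2 + σ) * k * R) ^ 2 / l * (t⁻¹ ^ 2 / (t ^ q * ε t))
        + 4 * (l * k * R) ^ 2 / α * (t ^ q * t⁻¹ ^ 2)
      ≤ (k * R ^ 2 / 2 + 4 * ((l ^ 2 + σ) * k * R) ^ 2 / l * K + 4 * (l * k * R) ^ 2 / α)
        * forcing ε q r t := by
    have hr2 : 0 < t ^ (r - 2) := Real.rpow_pos_of_pos ht0 _
    have hq2 : 0 < t ^ (2 * q - 1) := Real.rpow_pos_of_pos ht0 _
    have e1 : (t ^ q) ^ 2 * t⁻¹ * ε t ≤ forcing ε q r t := by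
      have : t ^ (2 * q - 1) = (t ^ q) ^ 2 * t⁻¹ := by
        rw [Real.rpow_sub_one ht0.ne', mul_comm 2 q, Real.rpow_mul ht0.le, Real.rpow_two,
          div_eq_mul_inv]
      rw [forcing, this]; linarith
    have e0 : t ^ (r - 2) ≤ forcing ε q r t := by
      have := mul_pos hq2 he
      rw [forcing]; linarith
    have e2 : t⁻¹ ^ 2 / (t ^ q * ε t) ≤ K * forcing ε q r t := h2.2.trans (by gcongr)
    have e3 : t ^ q * t⁻¹ ^ 2 ≤ forcing ε q r t := by
      refine le_trans ?_ e0
      rw [Real.rpow_sub ht0, Real.rpow_two, inv_pow, ← div_eq_mul_inv]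
      gcongr
      exact h.params.q_lt_r.le
    calc _ ≤ k * R ^ 2 / 2 * forcing ε q r t
        + 4 * ((l ^ 2 + σ) * k * R) ^ 2 / l * (K * forcing ε q r t)
        + 4 * (l * k * R) ^ 2 / α * forcing ε q r t := by gcongr
      _ = _ := by ring
  have hlt := hdis.trans_lt (lt_of_le_of_lt (by
    simp only [dissipation]
    linarith) hρ)
  have hslope : Tendsto (slope (energyMajorant g ε α β γ q R x v (z t) t) t) (𝓝[>] t)
      (𝓝 _) := (hasDerivAt_iff_tendsto_slope.1 hder).mono_left
        (nhdsWithin_mono t fun s hs => ne_of_gt hs)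
  filter_upwards [hslope.eventually (gt_mem_nhds hlt), self_mem_nhdsWithin] with s hs hst
  refine lt_of_le_of_lt ?_ hs
  have hst' : t < s := hst
  have hs0 : s ∈ Ici t₀ := ht.le.trans hst'.le
  have hmaj := energy_le_energyMajorant h.convex h.diff (β := β) (γ := γ) (q := q) hα x v
    (h.params.ε_pos s hs0) (h.params.anti ht' hs0 hst'.le) (h.z_min s hs0) (h.z_min t ht')
    (h.norm_z_le hs0)
  rw [slope_def_field, slope_def_field, energyMajorant_self]
  have : 0 ≤ s - t := by linarith
  gcongr

/-- The weight `t^(2q)` loses only `t^q ≤ t^r` against the dissipation. The weakest term is `ε t^q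
‖u‖²`, and there `t^(-r) ≤ K t^q ε` is exactly what is needed. -/
theorem energy_le_dissipation : ∃ c, 0 < c ∧ ∀ᶠ t in atTop,
    c * t ^ (-r) * energy g ε α β γ q x v z t ≤ dissipation g ε α β γ q x v z t := by
  have hα := h.params.α_pos
  obtain ⟨K, hK, hK'⟩ := h.params.eventually_inv_sq_div_le
  set l := α / 4 with hl
  set σ := l * (α - l) with hσ
  have hσ0 : 0 < σ := by rw [hσ, hl]; nlinarith
  set c := min (α / 32) (α / 64 / (K * (l ^ 2 + σ / 2))) with hc
  have hc0 : 0 < c := lt_min (by positivity) (by positivity)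
  refine ⟨c, hc0, ?_⟩
  filter_upwards [hK', eventually_ge_atTop t₀, eventually_ge_atTop 1] with t h1 ht ht1
  have ht0 : 0 < t := h.pos ht
  have hτ : 0 < t ^ q := Real.rpow_pos_of_pos ht0 q
  have hr : 0 < t ^ (-r) := Real.rpow_pos_of_pos ht0 (-r)
  have he := h.params.ε_pos t ht
  have hG := h.gap_nonneg ht (x t + betaFun γ β q t • v t)
  have hp := (h.dissipation_parts_nonneg ht).2.2.1
  have hτr : t ^ (-r) * (t ^ q) ^ 2 ≤ t ^ q := by
    have h2 : t ^ (-r) * t ^ q ≤ 1 := by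
      rw [← Real.rpow_add ht0]
      exact Real.rpow_le_one_of_one_le_of_nonpos ht1 (by linarith [h.params.q_lt_r])
    calc _ = (t ^ (-r) * t ^ q) * t ^ q := by ring
      _ ≤ 1 * t ^ q := by gcongr
      _ = _ := one_mul _
  have hw : ‖l • (x t - z t) + t ^ q • v t‖ ^ 2
      ≤ 2 * l ^ 2 * ‖x t - z t‖ ^ 2 + 2 * (t ^ q) ^ 2 * ‖v t‖ ^ 2 := by
    have h3 := norm_add_le (l • (x t - z t)) (t ^ q • v t)
    rw [norm_smul, norm_smul, Real.norm_of_nonneg hτ.le, Real.norm_of_nonneg (by positivity)] at h3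
    have h4 := pow_le_pow_left₀ (norm_nonneg _) h3 2
    nlinarith [sq_nonneg (l * ‖x t - z t‖ - t ^ q * ‖v t‖)]
  have hE : energy g ε α β γ q x v z t
      ≤ (t ^ q) ^ 2 * (regObj g ε t (x t + betaFun γ β q t • v t) - regObj g ε t (z t))
        + (t ^ q) ^ 2 * ‖v t‖ ^ 2 + (l ^ 2 + σ / 2) * ‖x t - z t‖ ^ 2 := by
    rw [energy, ← hl, ← hσ]
    linarith
  have hcα : c ≤ α / 32 := min_le_left _ _
  have hcK : c * (K * (l ^ 2 + σ / 2)) ≤ α / 64 :=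
    (le_div_iff₀ (by positivity)).1 (min_le_right _ _)
  have i1 : c * (t ^ (-r) * (t ^ q) ^ 2) ≤ α / 32 * t ^ q := by gcongr
  have i2 : c * t ^ (-r) * (l ^ 2 + σ / 2) ≤ α / 64 * (t ^ q * ε t) := by
    calc c * t ^ (-r) * (l ^ 2 + σ / 2) ≤ c * (K * (t ^ q * ε t)) * (l ^ 2 + σ / 2) := by
          gcongr; exact h1.1
      _ = c * (K * (l ^ 2 + σ / 2)) * (t ^ q * ε t) := by ring
      _ ≤ _ := by gcongr
  have j1 := mul_le_mul_of_nonneg_right i1 hG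
  have j2 := mul_le_mul_of_nonneg_right i1 (sq_nonneg ‖v t‖)
  have j3 := mul_le_mul_of_nonneg_right i2 (sq_nonneg ‖x t - z t‖)
  have j4 := mul_le_mul_of_nonneg_left hE (by positivity : 0 ≤ c * t ^ (-r))
  have j5 : 0 ≤ α * t ^ q * (regObj g ε t (x t + betaFun γ β q t • v t) - regObj g ε t (z t)) := by
    positivity
  simp only [dissipation]
  linarith

end Trajectory

end Decay

/-! ### The barrier bound on the energy and the integrability of the dissipation. -/

namespace Trajectory

variable {H : Type*} [NormedAddCommGroup H] [InnerProductSpace ℝ H] [CompleteSpace H]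
  {g : H → ℝ} {ε : ℝ → ℝ} {α β γ q r t₀ : ℝ} {x v z : ℝ → H} {xs : H}
  (h : Trajectory g ε α β γ q r t₀ x v z xs)

include h

theorem hasDerivAt_rpow_mul_forcing {k t : ℝ} (hk : 0 ≤ k) (ht : t₀ < t)
    (hε : -deriv ε t ≤ k * t⁻¹ * ε t) :
    ∃ Z', HasDerivAt (fun s => s ^ r * forcing ε q r s) Z' t ∧
      -((2 + k) * t ^ (r - 1) * forcing ε q r t) ≤ Z' := by
  have ht0 := h.pos ht.le
  have he := h.params.ε_pos t ht.le
  have hd : ∀ a : ℝ, HasDerivAt (fun s : ℝ => s ^ a) (a * (t ^ a * t⁻¹)) t := fun a => by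
    refine (Real.hasDerivAt_rpow_const (Or.inl ht0.ne')).congr_deriv ?_
    rw [Real.rpow_sub_one ht0.ne', div_eq_mul_inv]
  refine ⟨_, (hd r).mul ((hd (r - 2)).add ((hd (2 * q - 1)).mul (h.params.hasDerivAt_ε ht))), ?_⟩
  have hr := Real.rpow_pos_of_pos ht0 r
  have hr2 := Real.rpow_pos_of_pos ht0 (r - 2)
  have hq2 := Real.rpow_pos_of_pos ht0 (2 * q - 1)
  have hi : 0 < t⁻¹ := inv_pos.2 ht0
  rw [Real.rpow_sub_one ht0.ne', div_eq_mul_inv, forcing]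
  have hq := h.params.q_pos
  have hqr := h.params.q_lt_r
  have i1 : 0 ≤ (2 * r + k) * (t ^ r * t⁻¹ * t ^ (r - 2)) :=
    mul_nonneg (by linarith) (by positivity)
  have i2 : 0 ≤ (r + 1 + 2 * q) * (t ^ r * t⁻¹ * t ^ (2 * q - 1) * ε t) :=
    mul_nonneg (by linarith) (by positivity)
  have i3 : 0 ≤ t ^ r * t ^ (2 * q - 1) * (k * t⁻¹ * ε t + deriv ε t) :=
    mul_nonneg (by positivity) (by linarith)
  linarith

theorem energy_le : ∃ M, 0 < M ∧ ∀ᶠ t in atTop,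
    energy g ε α β γ q x v z t ≤ M * (t ^ r * forcing ε q r t) := by
  obtain ⟨C, hC, hslope⟩ := h.energy_slope_lt
  obtain ⟨c, hc, hdis⟩ := h.energy_le_dissipation
  obtain ⟨k, hk, hk'⟩ := h.params.exists_neg_deriv_ε_le
  have hlim : Tendsto (fun t : ℝ => (2 + k) * t ^ (r - 1)) atTop (𝓝 0) := by
    have := (tendsto_rpow_neg_atTop (sub_pos.2 h.params.r_lt_one)).const_mul (2 + k)
    simpa using this
  obtain ⟨T, hT⟩ := eventually_atTop.1 (hslope.and (hdis.and (hk'.and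
    ((hlim.eventually (gt_mem_nhds (by positivity : 0 < c / 2))).and (eventually_gt_atTop t₀)))))
  have hTt₀ : t₀ < T := (hT T le_rfl).2.2.2.2
  have hFpos : ∀ t, T ≤ t → 0 < t ^ r * forcing ε q r t := fun t ht =>
    mul_pos (Real.rpow_pos_of_pos (h.pos (hTt₀.le.trans ht)) _) (h.forcing_pos (hTt₀.le.trans ht))
  -- The first entry makes `C < M c / 2`, which gives strict descent where the energy touches the
  -- barrier; the second puts the energy below the barrier at `T`.
  set M := max (2 * C / c + 1) (energy g ε α β γ q x v z T / (T ^ r * forcing ε q r T)) with hM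
  have hM0 : 0 < M := lt_of_lt_of_le (by positivity) (le_max_left _ _)
  refine ⟨M, hM0, ?_⟩
  have hZ : ∀ t, ∃ Z', T ≤ t → HasDerivAt (fun s => s ^ r * forcing ε q r s) Z' t ∧
      -((2 + k) * t ^ (r - 1) * forcing ε q r t) ≤ Z' := fun t => by
    by_cases ht : T ≤ t
    · obtain ⟨Z', hZ'⟩ := h.hasDerivAt_rpow_mul_forcing hk (hTt₀.trans_le ht) (hT t ht).2.2.1
      exact ⟨Z', fun _ => hZ'⟩
    · exact ⟨0, fun h' => absurd h' ht⟩
  choose Z' hZ' using hZ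
  filter_upwards [eventually_ge_atTop T] with t ht
  refine image_le_of_liminf_slope_right_lt_deriv_boundary' (a := T) (b := t)
    (f' := fun s => -dissipation g ε α β γ q x v z s + C * forcing ε q r s)
    (B := fun s => M * (s ^ r * forcing ε q r s)) (B' := fun s => M * Z' s)
    (h.energy_cont.mono fun s hs => hTt₀.le.trans hs.1) ?_ ?_ ?_ ?_ ?_ ⟨ht, le_rfl⟩
  · intro s hs ρ hρ
    exact ((hT s hs.1).1 ρ hρ).frequently
  · exact (div_le_iff₀ (hFpos T le_rfl)).1 (le_max_right _ _)
  · intro s hs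
    exact ((hZ' s hs.1).1.continuousAt.const_mul M).continuousWithinAt
  · intro s hs
    exact ((hZ' s hs.1).1.const_mul M).hasDerivWithinAt
  -- At a contact point the dissipation is at least `c M F`, while the barrier falls at rate at most
  -- `M (c/2) F`. The remaining `M (c/2) F` beats the forcing `C F`.
  · intro s hs hE
    obtain ⟨-, h1, -, h2, h3⟩ := hT s hs.1
    have h4 := (hZ' s hs.1).2
    have hs0 := h.pos h3.le
    have hF := h.forcing_pos h3.le
    rw [hE] at h1
    have e1 : c * s ^ (-r) * (M * (s ^ r * forcing ε q r s)) = c * M * forcing ε q r s := by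
      have : s ^ (-r) * s ^ r = 1 := by
        rw [← Real.rpow_add hs0, neg_add_cancel, Real.rpow_zero]
      calc _ = c * M * forcing ε q r s * (s ^ (-r) * s ^ r) := by ring
        _ = _ := by rw [this, mul_one]
    rw [e1] at h1
    have h5 := mul_le_mul_of_nonneg_left h4 hM0.le
    have h6 : C < M * (c / 2) := by
      have h7 : 2 * C / c + 1 ≤ M := le_max_left _ _
      have h8 : 2 * C / c * (c / 2) = C := by field_simp
      nlinarith
    have h9 := mul_lt_mul_of_pos_right h6 hF
    have h10 : M * ((2 + k) * s ^ (r - 1) * forcing ε q r s)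
        ≤ M * (c / 2 * forcing ε q r s) := by gcongr
    linarith

theorem integrableOn_forcing (hint : IntegrableOn (fun t => t ^ (2 * q - 1) * ε t) (Ioi t₀)) :
    IntegrableOn (forcing ε q r) (Ioi t₀) :=
  (integrableOn_Ioi_rpow_of_lt (by linarith [h.params.r_lt_one]) h.params.t₀_pos).add hint

theorem dissipation_nonneg {t : ℝ} (ht : t ∈ Ici t₀) : 0 ≤ dissipation g ε α β γ q x v z t := by
  obtain ⟨h1, h2, h3, h4⟩ := h.dissipation_parts_nonneg ht
  unfold dissipation
  positivity

theorem energy_nonneg {t : ℝ} (ht : t ∈ Ici t₀) : 0 ≤ energy g ε α β γ q x v z t := by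
  have hα := h.params.α_pos
  have hσ : 0 < α / 4 * (α - α / 4) := by nlinarith
  have hG := h.gap_nonneg ht (x t + betaFun γ β q t • v t)
  unfold energy
  positivity

theorem integrableOn_dissipation
    (hint : IntegrableOn (fun t => t ^ (2 * q - 1) * ε t) (Ioi t₀)) :
    IntegrableOn (dissipation g ε α β γ q x v z) (Ioi t₀) := by
  obtain ⟨C, hC, hslope⟩ := h.energy_slope_lt
  have hF := h.integrableOn_forcing hint
  obtain ⟨T, hT⟩ := eventually_atTop.1 (hslope.and (eventually_gt_atTop t₀))
  have hTt₀ : t₀ < T := (hT T le_rfl).2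
  have hsub : ∀ b, Icc T b ⊆ Ici t₀ := fun b s hs => hTt₀.le.trans hs.1
  have hDc := h.dissipation_cont
  have hFc := h.forcing_cont
  have hbound : ∀ b, T ≤ b → ∫ s in T..b, ‖dissipation g ε α β γ q x v z s‖
      ≤ energy g ε α β γ q x v z T + C * ∫ s in Ioi t₀, forcing ε q r s := fun b hb => by
    -- Comparing the energy with the primitive of `φ` integrates the Dini inequality without
    -- differentiating the energy.
    set φ : ℝ → ℝ := fun s => C * forcing ε q r s - dissipation g ε α β γ q x v z s with hφ
    have hφc : ContinuousOn φ (Ici t₀) := (hFc.const_mul C).sub hDc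
    have hφi : ∀ s ∈ Icc T b, IntervalIntegrable φ volume T s := fun s hs =>
      ContinuousOn.intervalIntegrable_of_Icc hs.1 (hφc.mono (hsub s))
    have hφd : ∀ s ∈ Icc T b, HasDerivAt (fun s => ∫ w in T..s, φ w) (φ s) s := fun s hs => by
      have hs' : Ici t₀ ∈ 𝓝 s := Ici_mem_nhds (hTt₀.trans_le hs.1)
      refine intervalIntegral.integral_hasDerivAt_right (hφi s hs) ?_ (hφc.continuousAt hs')
      exact ContinuousOn.stronglyMeasurableAtFilter_nhdsWithin hφc measurableSet_Ici s |>.filter_mono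
        (by rw [nhdsWithin_eq_nhds.2 hs'])
    have h1 := image_le_of_liminf_slope_right_le_deriv_boundary (a := T) (b := b)
      (f := energy g ε α β γ q x v z)
      (B := fun s => energy g ε α β γ q x v z T + ∫ w in T..s, φ w) (B' := φ)
      (h.energy_cont.mono (hsub b)) (by simp)
      (fun s hs => ((hφd s hs).continuousAt.const_add _).continuousWithinAt)
      (fun s hs => ((hφd s ⟨hs.1, hs.2.le⟩).const_add _).hasDerivWithinAt)
      (fun s hs ρ hρ => ((hT s hs.1).1 ρ (by simp only [hφ] at hρ; linarith)).frequently)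
      ⟨hb, le_rfl⟩
    have hDi : IntervalIntegrable (dissipation g ε α β γ q x v z) volume T b :=
      ContinuousOn.intervalIntegrable_of_Icc hb (hDc.mono (hsub b))
    have hFi : IntervalIntegrable (forcing ε q r) volume T b :=
      ContinuousOn.intervalIntegrable_of_Icc hb (hFc.mono (hsub b))
    have h2 : ∫ w in T..b, φ w = C * (∫ w in T..b, forcing ε q r w)
        - ∫ w in T..b, dissipation g ε α β γ q x v z w := by
      rw [intervalIntegral.integral_sub (hFi.const_mul C) hDi,
        intervalIntegral.integral_const_mul]
    have h3 : ∫ w in T..b, ‖dissipation g ε α β γ q x v z w‖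
        = ∫ w in T..b, dissipation g ε α β γ q x v z w := by
      refine intervalIntegral.integral_congr fun w hw => ?_
      rw [uIcc_of_le hb] at hw
      exact Real.norm_of_nonneg (h.dissipation_nonneg (hsub b hw))
    have h4 : ∫ w in T..b, forcing ε q r w ≤ ∫ s in Ioi t₀, forcing ε q r s := by
      rw [intervalIntegral.integral_of_le hb]
      refine setIntegral_mono_set hF ?_ ?_
      · filter_upwards [ae_restrict_mem measurableSet_Ioi] with s hs
        exact (h.forcing_pos (mem_Ici.2 (le_of_lt (mem_Ioi.1 hs)))).le
      · exact Eventually.of_forall fun s hs => hTt₀.trans hs.1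
    have h5 := mul_le_mul_of_nonneg_left h4 hC
    have h6 := h.energy_nonneg (t := b) (hTt₀.le.trans hb)
    rw [h3]
    linarith
  have h1 : IntegrableOn (dissipation g ε α β γ q x v z) (Ioi T) := by
    refine integrableOn_Ioi_of_intervalIntegral_norm_bounded _ T (fun b : ℝ => ?_) tendsto_id
      ((eventually_ge_atTop T).mono hbound)
    exact ((hDc.mono (hsub b)).integrableOn_Icc).mono_set Ioc_subset_Icc_self
  have h2 : IntegrableOn (dissipation g ε α β γ q x v z) (Ioc t₀ T) :=
    ((hDc.mono fun s hs => hs.1).integrableOn_Icc).mono_set Ioc_subset_Icc_self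
  rw [← Ioc_union_Ioi_eq_Ioi hTt₀.le]
  exact h2.union h1

omit h in
theorem integrableOn_Ioi_of_eventually_norm_le {f D : ℝ → ℝ} {t₀ C : ℝ} (hf : ContinuousOn f (Ici t₀))
    (hD : IntegrableOn D (Ioi t₀)) (hfD : ∀ᶠ t in atTop, ‖f t‖ ≤ C * ‖D t‖) :
    IntegrableOn f (Ioi t₀) := by
  refine (LocallyIntegrableOn.integrableOn_of_isBigO_atTop
    (hf.locallyIntegrableOn measurableSet_Ici) (IsBigO.of_bound C hfD)
    ⟨Ioi t₀, Ioi_mem_atTop t₀, hD⟩).mono_set Ioi_subset_Ici_self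

end Trajectory

/-! ### Rates, convergence to the curve of minimizers, and integral estimates. -/

namespace Trajectory

variable {H : Type*} [NormedAddCommGroup H] [InnerProductSpace ℝ H] [CompleteSpace H]
  {g : H → ℝ} {ε : ℝ → ℝ} {α β γ q r t₀ : ℝ} {x v z : ℝ → H} {xs : H}
  (h : Trajectory g ε α β γ q r t₀ x v z xs)

omit [InnerProductSpace ℝ H] [CompleteSpace H] in
theorem norm_sub_sq_le_two_mul (a b : H) : ‖a - b‖ ^ 2 ≤ 2 * ‖a‖ ^ 2 + 2 * ‖b‖ ^ 2 := by
  have h1 := pow_le_pow_left₀ (norm_nonneg _) (norm_sub_le a b) 2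
  nlinarith [sq_nonneg (‖a‖ - ‖b‖)]

include h

theorem rpow_mul_forcing_eq {t : ℝ} (ht : t ∈ Ici t₀) :
    t ^ r * forcing ε q r t = (t ^ q) ^ 2 * (t ^ (2 * r - 2 * q - 2) + ε t * t ^ (r - 1)) := by
  have ht0 := h.pos ht
  have e1 : t ^ r * t ^ (r - 2) = (t ^ q) ^ 2 * t ^ (2 * r - 2 * q - 2) := by
    rw [← Real.rpow_natCast, ← Real.rpow_mul ht0.le, ← Real.rpow_add ht0, ← Real.rpow_add ht0]
    congr 1; push_cast; ring
  have e2 : t ^ r * t ^ (2 * q - 1) = (t ^ q) ^ 2 * t ^ (r - 1) := by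
    rw [← Real.rpow_natCast, ← Real.rpow_mul ht0.le, ← Real.rpow_add ht0, ← Real.rpow_add ht0]
    congr 1; push_cast; ring
  calc _ = t ^ r * t ^ (r - 2) + t ^ r * t ^ (2 * q - 1) * ε t := by rw [forcing]; ring
    _ = _ := by rw [e1, e2]; ring

theorem rpow_mul_forcing_le_sq {t : ℝ} (ht : t ∈ Ici t₀) :
    t ^ r * forcing ε q r t ≤ (t ^ (r - 1) + √(ε t) * t ^ ((2 * q + r - 1) / 2)) ^ 2 := by
  have ht0 := h.pos ht
  have he := h.params.ε_pos t ht
  have e1 : (t ^ (r - 1)) ^ 2 = t ^ r * t ^ (r - 2) := by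
    rw [← Real.rpow_natCast, ← Real.rpow_mul ht0.le, ← Real.rpow_add ht0]
    congr 1; push_cast; ring
  have e2 : (t ^ ((2 * q + r - 1) / 2)) ^ 2 = t ^ r * t ^ (2 * q - 1) := by
    rw [← Real.rpow_natCast, ← Real.rpow_mul ht0.le, ← Real.rpow_add ht0]
    congr 1; push_cast; ring
  have e3 : 0 ≤ t ^ (r - 1) * (√(ε t) * t ^ ((2 * q + r - 1) / 2)) := by positivity
  rw [add_sq, mul_pow, Real.sq_sqrt he.le, e1, e2, forcing]
  linarith

theorem rate_eq {t : ℝ} (ht : t ∈ Ici t₀) :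
    t ^ (r - 1) + √(ε t) * t ^ ((2 * q + r - 1) / 2)
      = t ^ q * (t ^ (r - q - 1) + √(ε t) * t ^ ((r - 1) / 2)) := by
  have ht0 := h.pos ht
  have e1 : t ^ (r - 1) = t ^ q * t ^ (r - q - 1) := by
    rw [← Real.rpow_add ht0]; congr 1; ring
  have e2 : t ^ ((2 * q + r - 1) / 2) = t ^ q * t ^ ((r - 1) / 2) := by
    rw [← Real.rpow_add ht0]; congr 1; ring
  rw [e1, e2]; ring

theorem exists_gap_le : ∃ M, 0 < M ∧ ∀ᶠ t in atTop,
    regObj g ε t (x t + betaFun γ β q t • v t) - regObj g ε t (z t)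
      ≤ M * (t ^ (2 * r - 2 * q - 2) + ε t * t ^ (r - 1)) := by
  obtain ⟨M, hM, hE⟩ := h.energy_le
  refine ⟨M, hM, ?_⟩
  filter_upwards [hE, eventually_ge_atTop t₀] with t h1 ht
  have hτ := Real.rpow_pos_of_pos (h.pos ht) q
  have hα := h.params.α_pos
  have hσ : 0 < α / 4 * (α - α / 4) := by nlinarith
  rw [h.rpow_mul_forcing_eq ht, energy] at h1
  have h2 : 0 ≤ 1 / 2 * ‖(α / 4) • (x t - z t) + t ^ q • v t‖ ^ 2 := by positivity
  have h3 : 0 ≤ (α / 4 * (α - α / 4)) / 2 * ‖x t - z t‖ ^ 2 := by positivity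
  refine le_of_mul_le_mul_left ?_ (by positivity : 0 < (t ^ q) ^ 2)
  linarith

theorem exists_norm_sub_le : ∃ M, 0 < M ∧ ∀ᶠ t in atTop,
    ‖x t - z t‖ ≤ M * (t ^ (r - 1) + √(ε t) * t ^ ((2 * q + r - 1) / 2)) ∧
    ‖x t - z t‖ ^ 2 ≤ M ^ 2 * (t ^ r * forcing ε q r t) ∧
    ‖v t‖ ≤ M * (t ^ (r - q - 1) + √(ε t) * t ^ ((r - 1) / 2)) := by
  obtain ⟨M, hM, hE⟩ := h.energy_le
  have hα := h.params.α_pos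
  have hσ : 0 < α / 4 * (α - α / 4) := by nlinarith
  set σ := α / 4 * (α - α / 4) with hσd
  set M₁ := √(2 * M / σ) with hM₁
  set M₂ := √(2 * M) with hM₂
  have hM₁0 : 0 < M₁ := Real.sqrt_pos.2 (by positivity)
  have hM₂0 : 0 < M₂ := Real.sqrt_pos.2 (by positivity)
  set M₃ := max M₁ (M₂ + α / 4 * M₁)
  have hM₃ : 0 < M₃ := lt_max_of_lt_left hM₁0
  refine ⟨M₃, hM₃, ?_⟩
  filter_upwards [hE, eventually_ge_atTop t₀] with t h1 ht
  have ht0 := h.pos ht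
  have hτ := Real.rpow_pos_of_pos ht0 q
  have hG := h.gap_nonneg ht (x t + betaFun γ β q t • v t)
  have hZ : 0 < t ^ r * forcing ε q r t :=
    mul_pos (Real.rpow_pos_of_pos ht0 r) (h.forcing_pos ht)
  have hS := h.rpow_mul_forcing_le_sq ht
  set S := t ^ (r - 1) + √(ε t) * t ^ ((2 * q + r - 1) / 2) with hSdef
  have hS0 : 0 ≤ S := by positivity
  rw [energy, ← hσd] at h1
  have h2 : 0 ≤ 1 / 2 * ‖(α / 4) • (x t - z t) + t ^ q • v t‖ ^ 2 := by positivity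
  have h3 : 0 ≤ σ / 2 * ‖x t - z t‖ ^ 2 := by positivity
  have h4 : 0 ≤ (t ^ q) ^ 2 * (regObj g ε t (x t + betaFun γ β q t • v t)
      - regObj g ε t (z t)) := by positivity
  have hu : ‖x t - z t‖ ^ 2 ≤ M₁ ^ 2 * (t ^ r * forcing ε q r t) := by
    rw [hM₁, Real.sq_sqrt (by positivity)]
    rw [div_mul_eq_mul_div, le_div_iff₀ hσ]
    linarith
  have hw : ‖(α / 4) • (x t - z t) + t ^ q • v t‖ ^ 2 ≤ M₂ ^ 2 * (t ^ r * forcing ε q r t) := by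
    rw [hM₂, Real.sq_sqrt (by positivity)]
    linarith
  have hu' : ‖x t - z t‖ ≤ M₁ * S := by
    refine abs_le_of_sq_le_sq' ?_ (by positivity) |>.2
    rw [mul_pow]
    exact hu.trans (by gcongr)
  have hw' : ‖(α / 4) • (x t - z t) + t ^ q • v t‖ ≤ M₂ * S := by
    refine abs_le_of_sq_le_sq' ?_ (by positivity) |>.2
    rw [mul_pow]
    exact hw.trans (by gcongr)
  have hM₁₃ : M₁ ≤ M₃ := le_max_left _ _
  refine ⟨hu'.trans (by gcongr), hu.trans (by gcongr), ?_⟩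
  -- The velocity is the difference of two controlled parts of the energy, `l u + t^q v` and `l u`.
  have h5 : t ^ q * ‖v t‖ ≤ M₂ * S + α / 4 * (M₁ * S) := by
    calc t ^ q * ‖v t‖ = ‖((α / 4) • (x t - z t) + t ^ q • v t) - (α / 4) • (x t - z t)‖ := by
          rw [add_sub_cancel_left, norm_smul, Real.norm_of_nonneg hτ.le]
      _ ≤ ‖(α / 4) • (x t - z t) + t ^ q • v t‖ + ‖(α / 4) • (x t - z t)‖ := norm_sub_le _ _
      _ = ‖(α / 4) • (x t - z t) + t ^ q • v t‖ + α / 4 * ‖x t - z t‖ := by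
          rw [norm_smul, Real.norm_of_nonneg (by positivity : 0 ≤ α / 4)]
      _ ≤ _ := by gcongr
  have h6 : M₂ * S + α / 4 * (M₁ * S) ≤ M₃ * S := by
    calc _ = (M₂ + α / 4 * M₁) * S := by ring
      _ ≤ _ := by gcongr; exact le_max_right _ _
  rw [hSdef, h.rate_eq ht] at h6
  rw [hSdef, h.rate_eq ht] at h5
  refine le_of_mul_le_mul_left ?_ hτ
  linarith

theorem tendsto_v : Tendsto v atTop (𝓝 0) := by
  obtain ⟨M, hM, hb⟩ := h.exists_norm_sub_le
  have hr := h.params.r_lt_one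
  have hq := h.params.q_pos
  have h1 : Tendsto (fun t : ℝ => t ^ (r - q - 1)) atTop (𝓝 0) := by
    have := tendsto_rpow_neg_atTop (y := -(r - q - 1)) (by linarith)
    simpa using this
  have h2 : Tendsto (fun t : ℝ => t ^ ((r - 1) / 2)) atTop (𝓝 0) := by
    have := tendsto_rpow_neg_atTop (y := -((r - 1) / 2)) (by linarith)
    simpa only [neg_neg] using this
  have h3 : Tendsto (fun t => M * (t ^ (r - q - 1) + √(ε t) * t ^ ((r - 1) / 2))) atTop (𝓝 0) := by
    simpa using (h1.add (h.params.lim.sqrt.mul h2)).const_mul M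
  exact squeeze_zero_norm' (hb.mono fun t ht => ht.2.2) h3

/-- The energy bound alone is not enough, since `t^(2q+r-1) ε` need not vanish. Where `ε` is too
large for it, quadratic growth bounds `‖y - x_t‖²` by twice the objective gap divided by `ε`, which
is then small. -/
theorem tendsto_sub : Tendsto (fun t => x t - z t) atTop (𝓝 0) := by
  obtain ⟨M, hM, hb⟩ := h.exists_norm_sub_le
  obtain ⟨M', hM', hgap⟩ := h.exists_gap_le
  have hr := h.params.r_lt_one
  have hpow : ∀ a : ℝ, a < 0 → Tendsto (fun t : ℝ => t ^ a) atTop (𝓝 0) := fun a ha => by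
    have := tendsto_rpow_neg_atTop (y := -a) (by linarith)
    simpa only [neg_neg] using this
  have hlim : Tendsto (fun t => M ^ 2 * (t ^ (2 * r - 2) + t ^ ((3 * r - 3) / 2))
      + 4 * M' * (t ^ ((3 * r - 3) / 2) + t ^ (r - 1))
      + 2 * (betaFun γ β q t ^ 2 * ‖v t‖ ^ 2)) atTop (𝓝 0) := by
    have h1 := hpow (2 * r - 2) (by linarith)
    have h2 := hpow ((3 * r - 3) / 2) (by linarith)
    have h3 := hpow (r - 1) (by linarith)
    have h4 := (h.params.tendsto_beta.pow 2).mul (h.tendsto_v.norm.pow 2)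
    simpa using (((h1.add h2).const_mul (M ^ 2)).add ((h2.add h3).const_mul (4 * M'))).add
      (h4.const_mul 2)
  have hsq : Tendsto (fun t => ‖x t - z t‖ ^ 2) atTop (𝓝 0) := by
    refine squeeze_zero' (Eventually.of_forall fun _ => sq_nonneg _) ?_ hlim
    filter_upwards [hb, hgap, eventually_ge_atTop t₀] with t h1 h2 ht
    have ht0 := h.pos ht
    have he := h.params.ε_pos t ht
    have p1 := Real.rpow_pos_of_pos ht0 (2 * r - 2)
    have p2 := Real.rpow_pos_of_pos ht0 ((3 * r - 3) / 2)
    have p3 := Real.rpow_pos_of_pos ht0 (r - 1)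
    have p4 : 0 ≤ betaFun γ β q t ^ 2 * ‖v t‖ ^ 2 := by positivity
    have e1 : t ^ r * forcing ε q r t = t ^ (2 * r - 2) + t ^ (2 * q + r - 1) * ε t := by
      rw [forcing, mul_add, ← mul_assoc, ← Real.rpow_add ht0, ← Real.rpow_add ht0]
      ring_nf
    -- The threshold balances the regimes: `t^(2q+r-1) ε` and `t^(2r-2q-2) / ε` have product
    -- `t^(3r-3)`, so one of them is at most its square root.
    rcases le_total (t ^ (2 * q + r - 1) * ε t) (t ^ ((3 * r - 3) / 2)) with hc | hc
    · have h3 := h1.2.1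
      rw [e1] at h3
      have h4 : M ^ 2 * (t ^ (2 * r - 2) + t ^ (2 * q + r - 1) * ε t)
          ≤ M ^ 2 * (t ^ (2 * r - 2) + t ^ ((3 * r - 3) / 2)) := by gcongr
      have h5 : 0 ≤ 4 * M' * (t ^ ((3 * r - 3) / 2) + t ^ (r - 1)) := by positivity
      linarith
    · have hc' : t ^ (2 * r - 2 * q - 2) ≤ t ^ ((3 * r - 3) / 2) * ε t := by
        have p5 := Real.rpow_pos_of_pos ht0 ((3 * r - 3) / 2 - (2 * q + r - 1))
        calc t ^ (2 * r - 2 * q - 2)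
            = t ^ ((3 * r - 3) / 2 - (2 * q + r - 1)) * t ^ ((3 * r - 3) / 2) := by
              rw [← Real.rpow_add ht0]; congr 1; ring
          _ ≤ t ^ ((3 * r - 3) / 2 - (2 * q + r - 1)) * (t ^ (2 * q + r - 1) * ε t) := by gcongr
          _ = t ^ ((3 * r - 3) / 2) * ε t := by
              rw [← mul_assoc, ← Real.rpow_add ht0, sub_add_cancel]
      have h3 := regObj_quadratic_growth h.convex h.diff (h.z_min t ht)
        (x t + betaFun γ β q t • v t)
      simp only [regObj] at h2
      have h4 : M' * (t ^ (2 * r - 2 * q - 2) + ε t * t ^ (r - 1))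
          ≤ M' * (t ^ ((3 * r - 3) / 2) * ε t + ε t * t ^ (r - 1)) := by gcongr
      have h5 : ‖x t + betaFun γ β q t • v t - z t‖ ^ 2
          ≤ 2 * M' * (t ^ ((3 * r - 3) / 2) + t ^ (r - 1)) := by
        refine le_of_mul_le_mul_left ?_ (by positivity : 0 < ε t / 2)
        linarith
      have h6 := norm_sub_sq_le_two_mul (x t + betaFun γ β q t • v t - z t)
        (betaFun γ β q t • v t)
      have e2 : x t + betaFun γ β q t • v t - z t - betaFun γ β q t • v t = x t - z t := by abel
      rw [e2, norm_smul, mul_pow, Real.norm_eq_abs, sq_abs] at h6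
      have h7 : 0 ≤ M ^ 2 * (t ^ (2 * r - 2) + t ^ ((3 * r - 3) / 2)) := by positivity
      linarith
  rw [tendsto_zero_iff_norm_tendsto_zero]
  have := hsq.sqrt
  simpa [Real.sqrt_sq] using this

theorem gap_isBigO : (fun t => regObj g ε t (x t + betaFun γ β q t • v t) - regObj g ε t (z t))
    =O[atTop] fun t => t ^ (2 * r - 2 * q - 2) + ε t * t ^ (r - 1) := by
  obtain ⟨M, hM, hb⟩ := h.exists_gap_le
  refine IsBigO.of_bound M ?_
  filter_upwards [hb, eventually_ge_atTop t₀] with t h1 ht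
  have ht0 := h.pos ht
  have he := h.params.ε_pos t ht
  rw [Real.norm_of_nonneg (h.gap_nonneg ht _), Real.norm_of_nonneg (by positivity)]
  exact h1

/-- Testing the minimality of `x_t` at `xs` shows that removing the regularization costs at most `ε
‖xs‖² / 2`. -/
theorem objective_isBigO : (fun t => g (x t + betaFun γ β q t • v t) - g xs)
    =O[atTop] fun t => t ^ (2 * r - 2 * q - 2) + ε t := by
  obtain ⟨M, hM, hb⟩ := h.exists_gap_le
  refine IsBigO.of_bound (M + ‖xs‖ ^ 2 / 2) ?_
  filter_upwards [hb, eventually_ge_atTop t₀, eventually_ge_atTop 1] with t h1 ht ht1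
  have ht0 := h.pos ht
  have he := h.params.ε_pos t ht
  have p1 := Real.rpow_pos_of_pos ht0 (2 * r - 2 * q - 2)
  have h2 := h.z_min t ht xs
  rw [Real.norm_of_nonneg (sub_nonneg.2 (h.xs_min _)), Real.norm_of_nonneg (by positivity)]
  have h3 : ε t * t ^ (r - 1) ≤ ε t := by
    have := Real.rpow_le_one_of_one_le_of_nonpos ht1
      (by linarith [h.params.r_lt_one] : r - 1 ≤ 0)
    exact mul_le_of_le_one_right he.le this
  have h4 : M * (t ^ (2 * r - 2 * q - 2) + ε t * t ^ (r - 1))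
      ≤ M * (t ^ (2 * r - 2 * q - 2) + ε t) := by gcongr
  have h5 : 0 ≤ ε t / 2 * ‖x t + betaFun γ β q t • v t‖ ^ 2 := by positivity
  have h6 : 0 ≤ ‖xs‖ ^ 2 / 2 * t ^ (2 * r - 2 * q - 2) := by positivity
  simp only [regObj] at h1 h2
  linarith

theorem velocity_isBigO : (fun t => ‖v t‖)
    =O[atTop] fun t => t ^ (r - q - 1) + √(ε t) * t ^ ((r - 1) / 2) := by
  obtain ⟨M, hM, hb⟩ := h.exists_norm_sub_le
  refine IsBigO.of_bound M ?_
  filter_upwards [hb, eventually_ge_atTop t₀] with t h1 ht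
  have ht0 := h.pos ht
  rw [norm_norm, Real.norm_of_nonneg (by positivity)]
  exact h1.2.2

theorem norm_sub_isBigO : (fun t => ‖x t - z t‖)
    =O[atTop] fun t => t ^ (r - 1) + √(ε t) * t ^ ((2 * q + r - 1) / 2) := by
  obtain ⟨M, hM, hb⟩ := h.exists_norm_sub_le
  refine IsBigO.of_bound M ?_
  filter_upwards [hb, eventually_ge_atTop t₀] with t h1 ht
  have ht0 := h.pos ht
  rw [norm_norm, Real.norm_of_nonneg (by positivity)]
  exact h1.1

section Integrals

variable (hint : IntegrableOn (fun t => t ^ (2 * q - 1) * ε t) (Ioi t₀))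

include hint

theorem integrableOn_gap : IntegrableOn (fun t => t ^ q *
    (regObj g ε t (x t + betaFun γ β q t • v t) - regObj g ε t (z t))) (Ioi t₀) := by
  refine integrableOn_Ioi_of_eventually_norm_le (C := 8 / α) ((h.rpow_cont q).mul h.gap_cont)
    (h.integrableOn_dissipation hint) ?_
  filter_upwards [eventually_ge_atTop t₀] with t ht
  obtain ⟨h1, h2, h3, h4⟩ := h.dissipation_parts_nonneg ht
  have hτ := Real.rpow_pos_of_pos (h.pos ht) q
  have hα := h.params.α_pos
  rw [Real.norm_of_nonneg (mul_nonneg hτ.le (h.gap_nonneg ht _)),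
    Real.norm_of_nonneg (h.dissipation_nonneg ht), div_mul_eq_mul_div, le_div_iff₀ hα, dissipation]
  linarith

theorem integrableOn_velocity : IntegrableOn (fun t => t ^ q * ‖v t‖ ^ 2) (Ioi t₀) := by
  refine integrableOn_Ioi_of_eventually_norm_le (C := 32 / α)
    ((h.rpow_cont q).mul (h.v_cont.norm.pow 2)) (h.integrableOn_dissipation hint) ?_
  filter_upwards [eventually_ge_atTop t₀] with t ht
  obtain ⟨h1, h2, h3, h4⟩ := h.dissipation_parts_nonneg ht
  have hτ := Real.rpow_pos_of_pos (h.pos ht) q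
  have hα := h.params.α_pos
  rw [Real.norm_of_nonneg (by positivity),
    Real.norm_of_nonneg (h.dissipation_nonneg ht), div_mul_eq_mul_div, le_div_iff₀ hα, dissipation]
  linarith

/-- The integrand differs from the dissipated `p` by `ε b v`. As `t^q ε b` is bounded, the kinetic
part of the dissipation controls the difference. -/
theorem integrableOn_gradient_of_gamma_pos (hγ : 0 < γ) :
    IntegrableOn (fun t => t ^ (2 * q) *
      ‖gradient g (x t + betaFun γ β q t • v t) + ε t • x t‖ ^ 2) (Ioi t₀) := by
  have hα := h.params.α_pos
  refine integrableOn_Ioi_of_eventually_norm_le (C := 8 / γ + 2 * (9 * α / 16) ^ 2 * (32 / α))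
    ((h.rpow_cont (2 * q)).mul ((h.grad_y_cont.add (h.ε_cont.smul h.x_cont)).norm.pow 2))
    (h.integrableOn_dissipation hint) ?_
  have hb2 : ∀ᶠ t in atTop, γ / 2 < betaFun γ β q t :=
    h.params.tendsto_beta.eventually (lt_mem_nhds (by linarith))
  filter_upwards [eventually_ge_atTop t₀, eventually_ge_atTop 1, hb2,
    h.params.eventually_rpow_mul_ε_mul_beta_le] with t ht ht1 hbγ hεb
  obtain ⟨h1, h2, h3, h4⟩ := h.dissipation_parts_nonneg ht
  have ht0 := h.pos ht
  have hτ := Real.rpow_pos_of_pos ht0 q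
  have hτ1 : 1 ≤ t ^ q := Real.one_le_rpow ht1 h.params.q_pos.le
  have he := h.params.ε_pos t ht
  have hb := h.params.beta_pos t ht
  have hD := h.dissipation_nonneg ht
  have e1 : t ^ (2 * q) = (t ^ q) ^ 2 := by
    rw [mul_comm 2 q, Real.rpow_mul ht0.le, Real.rpow_two]
  rw [Real.norm_of_nonneg (by positivity), Real.norm_of_nonneg hD, e1]
  set b := betaFun γ β q t with hbdef
  set p := gradient g (x t + b • v t) + ε t • (x t + b • v t) with hp
  have e2 : gradient g (x t + b • v t) + ε t • x t = p - (ε t * b) • v t := by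
    rw [hp, smul_add, smul_smul]; abel
  have h5 := norm_sub_sq_le_two_mul p ((ε t * b) • v t)
  rw [norm_smul, mul_pow, Real.norm_eq_abs, sq_abs] at h5
  rw [e2]
  have h6 : 1 / 2 * (t ^ q) ^ 2 * b * ‖p‖ ^ 2 ≤ dissipation g ε α β γ q x v z t := by
    simp only [dissipation, ← hbdef, ← hp]; linarith
  have h7 : α / 32 * t ^ q * ‖v t‖ ^ 2 ≤ dissipation g ε α β γ q x v z t := by
    simp only [dissipation, ← hbdef, ← hp]; linarith
  have h8 : (t ^ q) ^ 2 * ‖p‖ ^ 2 ≤ 4 / γ * dissipation g ε α β γ q x v z t := by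
    rw [div_mul_eq_mul_div, le_div_iff₀ hγ]
    have : 1 / 2 * (t ^ q) ^ 2 * (γ / 2) * ‖p‖ ^ 2 ≤ 1 / 2 * (t ^ q) ^ 2 * b * ‖p‖ ^ 2 := by
      gcongr
    linarith
  have h9 : ‖v t‖ ^ 2 ≤ 32 / α * dissipation g ε α β γ q x v z t := by
    rw [div_mul_eq_mul_div, le_div_iff₀ hα]
    have : α / 32 * 1 * ‖v t‖ ^ 2 ≤ α / 32 * t ^ q * ‖v t‖ ^ 2 := by gcongr
    linarith
  have h10 : (t ^ q * ε t * b) ^ 2 * ‖v t‖ ^ 2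
      ≤ (9 * α / 16) ^ 2 * (32 / α * dissipation g ε α β γ q x v z t) := by gcongr
  calc (t ^ q) ^ 2 * ‖p - (ε t * b) • v t‖ ^ 2
      ≤ (t ^ q) ^ 2 * (2 * ‖p‖ ^ 2 + 2 * ((ε t * b) ^ 2 * ‖v t‖ ^ 2)) := by gcongr
    _ = 2 * ((t ^ q) ^ 2 * ‖p‖ ^ 2) + 2 * ((t ^ q * ε t * b) ^ 2 * ‖v t‖ ^ 2) := by ring
    _ ≤ 2 * (4 / γ * dissipation g ε α β γ q x v z t)
        + 2 * ((9 * α / 16) ^ 2 * (32 / α * dissipation g ε α β γ q x v z t)) := by gcongr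
    _ = _ := by ring

/-- Now `t^(2q) β(t) = β t^q`, so the dissipation controls `t^q ‖p‖²`. Replacing `p` by `∇g(y)`
costs `t^(2q-1) ε² ‖y‖²`, eventually at most the integrable `t^(2q-1) ε` because `ε ‖y‖² → 0`; this
uses the convergence of the trajectory. -/
theorem integrableOn_gradient_of_gamma_eq_zero (hz : Tendsto z atTop (𝓝 xs)) (hγ : γ = 0) :
    IntegrableOn (fun t => t ^ (2 * q - 1) *
      ‖gradient g (x t + betaFun γ β q t • v t)‖ ^ 2) (Ioi t₀) := by
  have hβ : 0 < β := by
    rcases h.params.gamma_beta with h1 | h1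
    · exact absurd hγ h1.ne'
    · exact h1.2
  have hx : Tendsto x atTop (𝓝 xs) := by simpa using h.tendsto_sub.add hz
  have hy : Tendsto (fun t => ε t * ‖x t + betaFun γ β q t • v t‖ ^ 2) atTop (𝓝 0) := by
    have h1 := (hx.add (h.params.tendsto_beta.smul h.tendsto_v)).norm.pow 2
    simpa using h.params.lim.mul h1
  refine integrableOn_Ioi_of_eventually_norm_le (C := 4 / β + 2)
    ((h.rpow_cont (2 * q - 1)).mul (h.grad_y_cont.norm.pow 2))
    ((h.integrableOn_dissipation hint).add hint) ?_
  filter_upwards [eventually_ge_atTop t₀, eventually_ge_atTop 1,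
    hy.eventually (gt_mem_nhds one_pos)] with t ht ht1 hy1
  obtain ⟨h1, h2, h3, h4⟩ := h.dissipation_parts_nonneg ht
  have ht0 := h.pos ht
  have hτ := Real.rpow_pos_of_pos ht0 q
  have hτ2 := Real.rpow_pos_of_pos ht0 (2 * q - 1)
  have he := h.params.ε_pos t ht
  have hD := h.dissipation_nonneg ht
  have e1 : t ^ (2 * q - 1) ≤ t ^ q := by
    gcongr
    linarith [h.params.q_lt_one]
  have e3 : (t ^ q) ^ 2 * betaFun γ β q t = β * t ^ q := by
    rw [betaFun, hγ, zero_add]; field_simp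
  rw [Pi.add_apply, Real.norm_of_nonneg (by positivity), Real.norm_of_nonneg (by positivity)]
  set y := x t + betaFun γ β q t • v t with hydef
  set p := gradient g y + ε t • y with hp
  have e2 : gradient g y = p - ε t • y := by rw [hp]; abel
  have h5 := norm_sub_sq_le_two_mul p (ε t • y)
  rw [norm_smul, mul_pow, Real.norm_eq_abs, sq_abs] at h5
  rw [e2]
  have h6 : 1 / 2 * (β * t ^ q) * ‖p‖ ^ 2 ≤ dissipation g ε α β γ q x v z t := by
    rw [← e3]
    simp only [dissipation, ← hydef, ← hp]; linarith
  have h8 : t ^ q * ‖p‖ ^ 2 ≤ 2 / β * dissipation g ε α β γ q x v z t := by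
    rw [div_mul_eq_mul_div, le_div_iff₀ hβ]
    linarith
  have h9 : t ^ (2 * q - 1) * ε t * (ε t * ‖y‖ ^ 2) ≤ t ^ (2 * q - 1) * ε t * 1 := by
    gcongr
  calc t ^ (2 * q - 1) * ‖p - ε t • y‖ ^ 2
      ≤ t ^ (2 * q - 1) * (2 * ‖p‖ ^ 2 + 2 * (ε t ^ 2 * ‖y‖ ^ 2)) := by gcongr
    _ = 2 * (t ^ (2 * q - 1) * ‖p‖ ^ 2) + 2 * (t ^ (2 * q - 1) * ε t * (ε t * ‖y‖ ^ 2)) := by ring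
    _ ≤ 2 * (t ^ q * ‖p‖ ^ 2) + 2 * (t ^ (2 * q - 1) * ε t * (ε t * ‖y‖ ^ 2)) := by gcongr
    _ ≤ 2 * (2 / β * dissipation g ε α β γ q x v z t) + 2 * (t ^ (2 * q - 1) * ε t * 1) := by
        gcongr
    _ ≤ 2 * (2 / β * dissipation g ε α β γ q x v z t) + 2 * (t ^ (2 * q - 1) * ε t * 1)
        + (2 * dissipation g ε α β γ q x v z t + 4 / β * (t ^ (2 * q - 1) * ε t)) :=
        le_add_of_nonneg_right (by positivity)
    _ = _ := by ring

end Integrals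

end Trajectory

/-! ### From the classical solution to the abstract trajectory, and the final assembly. -/

theorem continuous_of_lipschitzOn_bounded {E F : Type*} [SeminormedAddCommGroup E]
    [PseudoEMetricSpace F] {f : E → F}
    (hf : ∀ B : Set E, Bornology.IsBounded B → ∃ L : NNReal, LipschitzOnWith L f B) :
    Continuous f := by
  refine continuous_iff_continuousAt.2 fun y => ?_
  obtain ⟨L, hL⟩ := hf _ (Metric.isBounded_ball (x := y) (r := 1))
  exact hL.continuousOn.continuousAt (Metric.ball_mem_nhds y one_pos)

theorem derivWithin_Ici_eq_deriv {F : Type*} [NormedAddCommGroup F] [NormedSpace ℝ F] (f : ℝ → F)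
    {a t : ℝ} (ht : a < t) : derivWithin f (Ici a) t = deriv f t :=
  derivWithin_of_mem_nhds (Ici_mem_nhds ht)

section Solution

variable {H : Type*} [NormedAddCommGroup H] [InnerProductSpace ℝ H] [CompleteSpace H]
  {g : H → ℝ} {ε : ℝ → ℝ} {α β γ q t₀ : ℝ} {u₀ v₀ : H} {x : ℝ → H}

/-- The velocity is taken as `derivWithin` on `Ici t₀`, since `deriv x t₀` depends on the irrelevant
values of `x` to the left of `t₀` and need not extend the velocity continuously. -/
theorem IsSolution.trajectory {r : ℝ} {z : ℝ → H} {xs : H}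
    (hx : IsSolution g ε α β γ q t₀ u₀ v₀ x)
    (hg_convex : ConvexOn ℝ univ g) (hg_diff : Differentiable ℝ g)
    (hg_cont : Continuous (gradient g)) (hp : Admissible α β γ q r t₀ ε)
    (hz : ∀ t ∈ Ici t₀, IsMinimizer (regObj g ε t) (z t)) (hxs : IsMinimizer g xs) :
    Trajectory g ε α β γ q r t₀ x (derivWithin x (Ici t₀)) z xs where
  convex := hg_convex
  diff := hg_diff
  grad_cont := hg_cont
  params := hp
  x_cont := hx.contDiffOn_one.continuousOn
  v_cont := hx.contDiffOn_one.continuousOn_derivWithin (uniqueDiffOn_Ici t₀) le_rfl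
  x_deriv t ht := by
    rw [derivWithin_Ici_eq_deriv x ht]
    exact ((hx.contDiffOn_one.differentiableOn one_ne_zero t ht.le).differentiableAt
      (Ici_mem_nhds ht)).hasDerivAt
  v_deriv t ht := by
    have h1 : ContDiffOn ℝ 1 (deriv x) (Ioi t₀) :=
      (hx.contDiffOn_two.deriv_of_isOpen isOpen_Ioi (by norm_num))
    have h2 : HasDerivAt (deriv x) (deriv (deriv x) t) t :=
      ((h1.differentiableOn one_ne_zero t ht).differentiableAt (Ioi_mem_nhds ht)).hasDerivAt
    refine ⟨deriv (deriv x) t, h2.congr_of_eventuallyEq ?_, ?_⟩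
    · filter_upwards [Ioi_mem_nhds ht] with s hs using derivWithin_Ici_eq_deriv x hs
    · rw [derivWithin_Ici_eq_deriv x ht]
      exact hx.equation t ht
  z_min := hz
  xs_min := hxs

end Solution

end TikhonovDS

theorem theorem4p1
    {H : Type*} [NormedAddCommGroup H] [InnerProductSpace ℝ H] [CompleteSpace H]
    (g : H → ℝ)
    (hg_convex : ConvexOn ℝ univ g)
    (hg_diff : Differentiable ℝ g)
    (hg_lip : ∀ B : Set H, Bornology.IsBounded B →
      ∃ L : NNReal, LipschitzOnWith L (gradient g) B)
    (hg_argmin : ∃ z, TikhonovDS.IsMinimizer g z)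
    (α β γ q t₀ : ℝ)
    (hα : 0 < α) (hq0 : 0 < q) (hq1 : q < 1) (ht₀ : 0 < t₀)
    (hγβ : 0 < γ ∨ (γ = 0 ∧ 0 < β))
    (hβ : β < 0 → |β / γ| ^ (1 / q) < t₀)
    (ε : ℝ → ℝ)
    (hε_smooth : ContDiffOn ℝ 1 ε (Ici t₀))
    (hε_nonneg : ∀ t ∈ Ici t₀, 0 ≤ ε t)
    (hε_anti : AntitoneOn ε (Ici t₀))
    (hε_lim : Tendsto ε atTop (𝓝 0))
    (r : ℝ) (hqr : q < r) (hr1 : r < 1)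
    (hC1 : ∃ K₁ : ℝ, 0 < K₁ ∧ ∀ᶠ t in atTop, K₁ / t ^ (r + q) ≤ ε t)
    (hC2 : γ ≠ 0 → ∀ᶠ t in atTop, ε t ≤ α / (2 * γ * t ^ q))
    (hC3 : ∃ K₃ : ℝ, 0 < K₃ ∧ ∀ᶠ t in atTop, (deriv ε t / ε t) ^ 2 ≤ K₃ / t ^ 2)
    (u₀ v₀ : H) (x : ℝ → H)
    (hx : TikhonovDS.IsSolution g ε α β γ q t₀ u₀ v₀ x) :
    -- the objects in the conclusion are well defined
    (∀ t ∈ Ici t₀, ∃! z, TikhonovDS.IsMinimizer (TikhonovDS.regObj g ε t) z) ∧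
    (∃! z, TikhonovDS.IsMinNormMinimizer g z) ∧
    ∀ (xmin : ℝ → H) (xstar : H),
      (∀ t ∈ Ici t₀, TikhonovDS.IsMinimizer (TikhonovDS.regObj g ε t) (xmin t)) →
      TikhonovDS.IsMinNormMinimizer g xstar →
      -- (i) strong convergence
      Tendsto x atTop (𝓝 xstar) ∧
      -- (ii) convergence rates
      ((fun t => TikhonovDS.regObj g ε t (x t + TikhonovDS.betaFun γ β q t • deriv x t)
            - TikhonovDS.regObj g ε t (xmin t))
          =O[atTop] fun t => t ^ (2 * r - 2 * q - 2) + ε t * t ^ (r - 1)) ∧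
      ((fun t => g (x t + TikhonovDS.betaFun γ β q t • deriv x t) - g xstar)
          =O[atTop] fun t => t ^ (2 * r - 2 * q - 2) + ε t) ∧
      ((fun t => ‖deriv x t‖)
          =O[atTop] fun t => t ^ (r - q - 1) + √(ε t) * t ^ ((r - 1) / 2)) ∧
      ((fun t => ‖x t - xmin t‖)
          =O[atTop] fun t => t ^ (r - 1) + √(ε t) * t ^ ((2 * q + r - 1) / 2)) ∧
      -- (iii) integral estimates
      (IntegrableOn (fun t => t ^ (2 * q - 1) * ε t) (Ioi t₀) →
        IntegrableOn (fun t => t ^ q *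
          (TikhonovDS.regObj g ε t (x t + TikhonovDS.betaFun γ β q t • deriv x t)
            - TikhonovDS.regObj g ε t (xmin t))) (Ioi t₀) ∧
        IntegrableOn (fun t => t ^ q * ‖deriv x t‖ ^ 2) (Ioi t₀) ∧
        (0 < γ → IntegrableOn (fun t => t ^ (2 * q) *
          ‖gradient g (x t + TikhonovDS.betaFun γ β q t • deriv x t) + ε t • x t‖ ^ 2)
            (Ioi t₀)) ∧
        (γ = 0 → IntegrableOn (fun t => t ^ (2 * q - 1) *
          ‖gradient g (x t + TikhonovDS.betaFun γ β q t • deriv x t)‖ ^ 2) (Ioi t₀))) := by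
  have hp : TikhonovDS.Admissible α β γ q r t₀ ε :=
    ⟨hα, hq0, hq1, ht₀, hγβ, hβ, hε_smooth, hε_anti, hε_lim, hqr, hr1, hC1, hC2, hC3⟩
  have hpos := hp.ε_pos
  have hex : ∀ t ∈ Ici t₀, ∃ z, TikhonovDS.IsMinimizer (TikhonovDS.regObj g ε t) z :=
    fun t ht => TikhonovDS.exists_minimizer_regObj hg_convex hg_diff.continuous hg_argmin
      (hpos t ht)
  have htik : ∀ z : ℝ → H, (∀ t ∈ Ici t₀, TikhonovDS.IsMinimizer (TikhonovDS.regObj g ε t) (z t)) →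
      ∃ w, TikhonovDS.IsMinNormMinimizer g w ∧ Tendsto z atTop (𝓝 w) := fun z hz =>
    TikhonovDS.exists_tendsto_minimizer_regObj hg_convex hg_diff hpos hε_anti hε_lim hg_argmin hz
  refine ⟨fun t ht => ?_, ?_, fun xmin xstar hmin hstar => ?_⟩
  · obtain ⟨z, hz⟩ := hex t ht
    exact ⟨z, hz, fun w hw =>
      TikhonovDS.minimizer_regObj_unique hg_convex (hpos t ht) hw hz⟩
  · choose! z hz using hex
    obtain ⟨w, hw, -⟩ := htik z hz
    exact ⟨w, hw, fun w' hw' => TikhonovDS.isMinNormMinimizer_unique hg_convex hw' hw⟩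
  obtain ⟨w, hw, hlim⟩ := htik xmin hmin
  -- Identifies the limit of the given curve `xmin` with the given `xstar`.
  obtain rfl := TikhonovDS.isMinNormMinimizer_unique hg_convex hw hstar
  have h := hx.trajectory hg_convex hg_diff
    (TikhonovDS.continuous_of_lipschitzOn_bounded hg_lip) hp hmin hstar.1
  have hv : ∀ᶠ t in atTop, derivWithin x (Ici t₀) t = deriv x t :=
    (eventually_gt_atTop t₀).mono fun t ht => TikhonovDS.derivWithin_Ici_eq_deriv x ht
  refine ⟨by simpa using h.tendsto_sub.add hlim, h.gap_isBigO.congr' ?_ EventuallyEq.rfl,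
    h.objective_isBigO.congr' ?_ EventuallyEq.rfl, h.velocity_isBigO.congr' ?_ EventuallyEq.rfl,
    h.norm_sub_isBigO, fun hint => ⟨?_, ?_, fun hγ => ?_, fun hγ => ?_⟩⟩
  · filter_upwards [hv] with t ht
    rw [ht]
  · filter_upwards [hv] with t ht
    rw [ht]
  · filter_upwards [hv] with t ht
    rw [ht]
  · refine (h.integrableOn_gap hint).congr_fun (fun t ht => ?_) measurableSet_Ioi
    simp only [TikhonovDS.derivWithin_Ici_eq_deriv x ht]
  · refine (h.integrableOn_velocity hint).congr_fun (fun t ht => ?_) measurableSet_Ioi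
    simp only [TikhonovDS.derivWithin_Ici_eq_deriv x ht]
  · refine (h.integrableOn_gradient_of_gamma_pos hint hγ).congr_fun (fun t ht => ?_)
      measurableSet_Ioi
    simp only [TikhonovDS.derivWithin_Ici_eq_deriv x ht]
  · refine (h.integrableOn_gradient_of_gamma_eq_zero hint hlim hγ).congr_fun (fun t ht => ?_)
      measurableSet_Ioi
    simp only [TikhonovDS.derivWithin_Ici_eq_deriv x ht]
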